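/- Let $(\Omega,\Sigma,\mu)$ be a $\sigma$-finite measure space and $L_0(\mu)$ the space of $\mu$-a.e. classes of real measurable functions. A quasi norm on a real vector space is a positive definite, absolutely homogeneous function $\|\cdot\|$ with $\|x+y\|\le K(\|x\|+\|y\|)$ for some constant $K$; a quasi Banach space is a space which is complete for a quasi norm. A quasi Köthe function space $X=X(\mu)$ is a linear subspace of $L_0(\mu)$ with a quasi norm $\|\cdot\|_X$ such that: (I) if $|x|\le|y|$ a.e., $x\in L_0(\mu)$, $y\in X$, then $x\in X$ and $\|x\|_X\le\|y\|_X$; (II) for some $0<t<\infty$, $\|(|x|^t+|y|^t)^{1/t}\|_X\le(\|x\|_X^t+\|y\|_X^t)^{1/t}$ for all $x,y\in X$; (III) every measurable set on which all functions in $X$ vanish a.e. is a null set, and $\|x_n\|_X\to\|x\|_X$ whenever $0\le x_n\uparrow x$ a.e. with $x_n,x\in X$. It is called a quasi Banach function space if it is complete, and $\sigma$-order continuous if $\|x_n\|_X\to0$ for each sequence in $X$ with $0\le x_n\downarrow0$ a.e. For $0<r<\infty$ let $X^r=\{x\in L_0(\mu):|x|^{1/r}\in X\}$, a linear space. $X$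 is $r$-convex if there is $c\ge0$ with $\|(\sum_k|x_k|^r)^{1/r}\|_X\le c\,(\sum_k\|x_k\|_X^r)^{1/r}$ for all finite families in $X$; the best such $c$ is $M^{(r)}(X)$. A map $T:X\to F$ into a quasi Banach space $F$ is homogeneous if $T(\lambda x)=\lambda Tx$ for all $\lambda\ge0$, $x\in X$, and $r$-concave if there is $c\ge0$ with $(\sum_k\|Tx_k\|_F^r)^{1/r}\le c\,\|(\sum_k|x_k|^r)^{1/r}\|_X$ for all finite families in $X$; the best such $c$ is $M_{(r)}(T)$. Let $0<r<\infty$, let $X(\mu)$ be an $r$-convex quasi Banach function space, $F$ a quasi Banach space and $T:X(\mu)\to F$ an $r$-concave homogeneous map. Then there is a linear functional $\varphi:X^r\to\mathbb R$, $\varphi\ge0$, with \[\sup_{\|x\|_X\le1}\varphi(|x|^r)^{1/r}\le M_{(r)}(T)\,M^{(r)}(X)\quad\text{and}\quad \|Tx\|_F\le\varphi(|x|^r)^{1/r}\ \text{ for all }x\in X.\] If moreover $X$ is $\sigma$-order continuous, $T$ is linear and $1\le r<\infty$, then there are $0\le f\in L_0(\mu)$ such that $M_f:X\to L_r(\mu)$,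 $M_fx=fx$, is well defined and bounded, and a bounded linear operator $R:L_r(\mu)\to F$ such that $T=RM_f$; if the quasi norm of $F$ is continuous (i.e. $\|x_n-x\|_F\to0$ implies $\|x_n\|_F\to\|x\|_F$, as for every norm and every $p$-norm), then $f$ and $R$ can be chosen with, in addition, \[\|M_f\|\,\|R\|\le M_{(r)}(T)\,M^{(r)}(X).\] -/

import Mathlib

open MeasureTheory Filter Topology

noncomputable section

/-! Quasi normed spaces over the reals, given by a vector space and a quasi norm on it. -/

/-- `q` is a quasi norm on the real vector space `V`. -/
structure IsQuasiNorm {V : Type*} [AddCommGroup V] [Module ℝ V] (q : V → ℝ) : Prop where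
  nonneg : ∀ x, 0 ≤ q x
  eq_zero : ∀ x, q x = 0 → x = 0
  smul : ∀ (c : ℝ) (x : V), q (c • x) = |c| * q x
  quasi_triangle : ∃ K : ℝ, ∀ x y, q (x + y) ≤ K * (q x + q y)

/-- Every Cauchy sequence for `q` converges for `q`. -/
def IsCompleteFor {V : Type*} [AddCommGroup V] (q : V → ℝ) : Prop :=
  ∀ u : ℕ → V, (∀ ε > 0, ∃ N, ∀ m ≥ N, ∀ n ≥ N, q (u m - u n) < ε) →
    ∃ x, Tendsto (fun n => q (u n - x)) atTop (𝓝 0)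

/-- `q` is a complete quasi norm, that is, `(V, q)` is a quasi Banach space. -/
structure IsQuasiBanachNorm {V : Type*} [AddCommGroup V] [Module ℝ V] (q : V → ℝ) : Prop
    extends IsQuasiNorm q where
  complete : IsCompleteFor q

/-- `q` is continuous for the (metrizable) topology that it defines. Every norm and every
`p`-norm has this property, but a general quasi norm need not have it. -/
def IsContinuousFor {V : Type*} [AddCommGroup V] (q : V → ℝ) : Prop :=
  ∀ (u : ℕ → V) (x : V), Tendsto (fun n => q (u n - x)) atTop (𝓝 0) →
    Tendsto (fun n => q (u n)) atTop (𝓝 (q x))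

/-- The map `A` is bounded with respect to the quasi norms `p` and `q`. -/
def IsBoundedFor {V W : Type*} (p : V → ℝ) (q : W → ℝ) (A : V → W) : Prop :=
  ∃ c : ℝ, 0 ≤ c ∧ ∀ x, q (A x) ≤ c * p x

/-- The operator (quasi) norm of `A`: the infimum of its bounds. -/
def opNormFor {V W : Type*} (p : V → ℝ) (q : W → ℝ) (A : V → W) : ℝ :=
  sInf {c : ℝ | 0 ≤ c ∧ ∀ x, q (A x) ≤ c * p x}

section

variable {Ω : Type*} [MeasurableSpace Ω] {μ : Measure Ω}

/-- The class of `ω ↦ |x ω| ^ r`. -/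
def absPow (x : Ω →ₘ[μ] ℝ) (r : ℝ) : Ω →ₘ[μ] ℝ :=
  AEEqFun.compMeasurable (fun t : ℝ => |t| ^ r) (by fun_prop) x

/-- The class of `(∑ₖ |xₖ| ^ r) ^ (1 / r)`. -/
def powSum (r : ℝ) {n : ℕ} (x : Fin n → Ω →ₘ[μ] ℝ) : Ω →ₘ[μ] ℝ :=
  absPow (∑ k, absPow (x k) r) (1 / r)

/-- A quasi Köthe function space over `μ`: a linear subspace of `L₀(μ)` with a quasi norm.
The values of `qnorm` outside of `carrier` have no meaning and are never used. -/
structure QuasiKotheSpace (μ : Measure Ω) where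
  carrier : Submodule ℝ (Ω →ₘ[μ] ℝ)
  qnorm : (Ω →ₘ[μ] ℝ) → ℝ
  isQuasiNorm : IsQuasiNorm (fun x : carrier => qnorm x)
  solid_mem : ∀ x y : Ω →ₘ[μ] ℝ, y ∈ carrier → |x| ≤ |y| → x ∈ carrier
  solid_norm : ∀ x y : Ω →ₘ[μ] ℝ, y ∈ carrier → |x| ≤ |y| → qnorm x ≤ qnorm y
  exists_power_triangle : ∃ t : ℝ, 0 < t ∧ ∀ x ∈ carrier, ∀ y ∈ carrier,
    qnorm (absPow (absPow x t + absPow y t) (1 / t)) ≤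
      (qnorm x ^ t + qnorm y ^ t) ^ (1 / t)
  full_support : ∀ A : Set Ω, MeasurableSet A →
    (∀ x ∈ carrier, ∀ᵐ ω ∂μ, ω ∈ A → x ω = 0) → μ A = 0
  fatou : ∀ (u : ℕ → Ω →ₘ[μ] ℝ) (x : Ω →ₘ[μ] ℝ), (∀ n, u n ∈ carrier) → x ∈ carrier →
    (∀ n, 0 ≤ u n) → Monotone u →
    (∀ᵐ ω ∂μ, Tendsto (fun n => u n ω) atTop (𝓝 (x ω))) →
    Tendsto (fun n => qnorm (u n)) atTop (𝓝 (qnorm x))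

namespace QuasiKotheSpace

/-- The quasi norm of `X` as a function on `X`. -/
def nrm (X : QuasiKotheSpace μ) (x : X.carrier) : ℝ := X.qnorm x

/-- Complete quasi Köthe function spaces are called quasi Banach function spaces. -/
def IsQuasiBanach (X : QuasiKotheSpace μ) : Prop := IsCompleteFor X.nrm

/-- `‖xₙ‖ → 0` for each sequence in `X` with `0 ≤ xₙ ↓ 0` almost everywhere. -/
def SigmaOrderContinuous (X : QuasiKotheSpace μ) : Prop :=
  ∀ u : ℕ → Ω →ₘ[μ] ℝ, (∀ n, u n ∈ X.carrier) → (∀ n, 0 ≤ u n) → Antitone u →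
    (∀ᵐ ω ∂μ, Tendsto (fun n => u n ω) atTop (𝓝 0)) →
    Tendsto (fun n => X.qnorm (u n)) atTop (𝓝 0)

/-- The constants in the definition of `r`-convexity of `X`. -/
def convexityBounds (X : QuasiKotheSpace μ) (r : ℝ) : Set ℝ :=
  {c : ℝ | 0 ≤ c ∧ ∀ (n : ℕ) (x : Fin n → Ω →ₘ[μ] ℝ), (∀ k, x k ∈ X.carrier) →
    X.qnorm (powSum r x) ≤ c * (∑ k, X.qnorm (x k) ^ r) ^ (1 / r)}

def IsConvex (X : QuasiKotheSpace μ) (r : ℝ) : Prop := (X.convexityBounds r).Nonempty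

/-- The best constant `M^(r)(X)` of an `r`-convex space `X`. -/
def convexityConst (X : QuasiKotheSpace μ) (r : ℝ) : ℝ := sInf (X.convexityBounds r)

/-- The constants in the definition of `r`-concavity of a map `T` from `X` into `(F, q)`. -/
def concavityBounds (X : QuasiKotheSpace μ) {F : Type*} (q : F → ℝ) (T : X.carrier → F)
    (r : ℝ) : Set ℝ :=
  {c : ℝ | 0 ≤ c ∧ ∀ (n : ℕ) (x : Fin n → X.carrier),
    (∑ k, q (T (x k)) ^ r) ^ (1 / r) ≤
      c * X.qnorm (powSum r fun k => (x k : Ω →ₘ[μ] ℝ))}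

def IsConcaveMap (X : QuasiKotheSpace μ) {F : Type*} (q : F → ℝ) (T : X.carrier → F)
    (r : ℝ) : Prop := (X.concavityBounds q T r).Nonempty

/-- The best constant `M_(r)(T)` of an `r`-concave map `T`. -/
def concavityConst (X : QuasiKotheSpace μ) {F : Type*} (q : F → ℝ) (T : X.carrier → F)
    (r : ℝ) : ℝ := sInf (X.concavityBounds q T r)

theorem mem_of_ae_bound (X : QuasiKotheSpace μ) {x y : Ω →ₘ[μ] ℝ} (hy : y ∈ X.carrier)
    (h : ∀ᵐ ω ∂μ, |x ω| ≤ |y ω|) : x ∈ X.carrier := by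
  refine X.solid_mem x y hy ?_
  rw [← AEEqFun.coeFn_le]
  filter_upwards [AEEqFun.coeFn_abs x, AEEqFun.coeFn_abs y, h] with ω h1 h2 h3
  rw [h1, h2]; exact h3

theorem coeFn_absPow (x : Ω →ₘ[μ] ℝ) (r : ℝ) : ∀ᵐ ω ∂μ, absPow x r ω = |x ω| ^ r :=
  AEEqFun.coeFn_compMeasurable _ _ x

/-- The `r`-th power `X^r(μ) = {x ∈ L₀(μ) | |x|^(1/r) ∈ X(μ)}` of `X`, for `r > 0`. -/
def power (X : QuasiKotheSpace μ) (r : ℝ) (hr : 0 < r) : Submodule ℝ (Ω →ₘ[μ] ℝ) where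
  carrier := {x | absPow x (1 / r) ∈ X.carrier}
  zero_mem' := by
    refine X.mem_of_ae_bound X.carrier.zero_mem ?_
    filter_upwards [coeFn_absPow (0 : Ω →ₘ[μ] ℝ) (1 / r),
      (AEEqFun.coeFn_zero : ⇑(0 : Ω →ₘ[μ] ℝ) =ᵐ[μ] 0)] with ω h1 h2
    rw [h1, h2]
    simp [Real.zero_rpow (inv_pos.2 hr).ne']
  add_mem' := by
    intro x y hx hy
    have hs : 0 < 1 / r := one_div_pos.2 hr
    refine X.mem_of_ae_bound
      (X.carrier.smul_mem ((2 : ℝ) ^ (1 / r)) (X.carrier.add_mem hx hy)) ?_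
    filter_upwards [coeFn_absPow (x + y) (1 / r), coeFn_absPow x (1 / r),
      coeFn_absPow y (1 / r), AEEqFun.coeFn_add x y,
      AEEqFun.coeFn_smul ((2 : ℝ) ^ (1 / r)) (absPow x (1 / r) + absPow y (1 / r)),
      AEEqFun.coeFn_add (absPow x (1 / r)) (absPow y (1 / r))] with ω h1 h2 h3 h4 h5 h6
    rw [h1, h4, h5, Pi.smul_apply, h6, Pi.add_apply, Pi.add_apply, h2, h3, smul_eq_mul]
    have ha : 0 ≤ |x ω| ^ (1 / r) := by positivity
    have hb : 0 ≤ |y ω| ^ (1 / r) := by positivity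
    have hc : 0 ≤ (2 : ℝ) ^ (1 / r) := by positivity
    have key : ∀ m : ℝ, 0 ≤ m → |x ω| ≤ m → |y ω| ≤ m →
        |x ω + y ω| ^ (1 / r) ≤ 2 ^ (1 / r) * m ^ (1 / r) := by
      intro m hm h1 h2
      rw [← Real.mul_rpow (by norm_num) hm]
      refine Real.rpow_le_rpow (abs_nonneg _) ?_ hs.le
      linarith [abs_add_le (x ω) (y ω)]
    rw [abs_of_nonneg (a := |x ω + y ω| ^ (1 / r)) (by positivity),
      abs_of_nonneg (mul_nonneg hc (add_nonneg ha hb))]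
    rcases le_total |x ω| |y ω| with hxy | hxy
    · exact (key _ (abs_nonneg _) hxy le_rfl).trans
        (mul_le_mul_of_nonneg_left (by linarith) hc)
    · exact (key _ (abs_nonneg _) le_rfl hxy).trans
        (mul_le_mul_of_nonneg_left (by linarith) hc)
  smul_mem' := by
    intro c x hx
    refine X.mem_of_ae_bound (X.carrier.smul_mem (|c| ^ (1 / r)) hx) ?_
    filter_upwards [coeFn_absPow (c • x) (1 / r), coeFn_absPow x (1 / r),
      AEEqFun.coeFn_smul c x,
      AEEqFun.coeFn_smul (|c| ^ (1 / r)) (absPow x (1 / r))] with ω h1 h2 h3 h4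
    rw [h1, h3, h4, Pi.smul_apply, Pi.smul_apply, h2, smul_eq_mul, smul_eq_mul, abs_mul,
      Real.mul_rpow (abs_nonneg _) (abs_nonneg _)]

theorem absPow_mem_power (X : QuasiKotheSpace μ) {r : ℝ} (hr : 0 < r) (x : X.carrier) :
    absPow (x : Ω →ₘ[μ] ℝ) r ∈ X.power r hr := by
  change absPow (absPow (x : Ω →ₘ[μ] ℝ) r) (1 / r) ∈ X.carrier
  refine X.mem_of_ae_bound x.2 ?_
  filter_upwards [coeFn_absPow (absPow (x : Ω →ₘ[μ] ℝ) r) (1 / r),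
    coeFn_absPow (x : Ω →ₘ[μ] ℝ) r] with ω h1 h2
  rw [h1, h2, abs_of_nonneg (a := |(x : Ω →ₘ[μ] ℝ) ω| ^ r) (by positivity),
    ← Real.rpow_mul (abs_nonneg _), mul_one_div_cancel hr.ne', Real.rpow_one, abs_abs]

/-- The element `|x| ^ r` of `X^r(μ)`, for `x ∈ X(μ)`. -/
def toPower (X : QuasiKotheSpace μ) {r : ℝ} (hr : 0 < r) (x : X.carrier) : X.power r hr :=
  ⟨absPow (x : Ω →ₘ[μ] ℝ) r, X.absPow_mem_power hr x⟩

end QuasiKotheSpace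

end

end

/-! Domination is a separation argument. Let `A` and `B` be the best concavity and convexity
constants. A positive functional `φ` on `X^r` with `q (T x) ^ r ≤ φ (|x| ^ r) ≤ (A * B * ‖x‖) ^ r`
must satisfy `φ y ≤ (A * B) ^ r * ∑_L ‖x‖ ^ r - ∑_L' q (T x) ^ r` whenever `y + ∑_L' |x| ^ r ≤ ∑_L
|x| ^ r`, for finite lists `L`, `L'`. Conversely, lists of length at most one already give back all
the conditions on `φ`. The infimum of these right-hand sides is sublinear in `y` as soon as it is
finite, and finiteness is what concavity of `T` followed by convexity of `X` provides. Hahn-Banach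
(`exists_linearMap_le_of_cone`) then gives `φ` (`exists_dominating_functional`).

If `X` is σ-order continuous, the upper bound makes `φ` σ-order continuous, hence countably additive
on indicators. Radon-Nikodym gives a density `h` (`exists_density_of_orderContinuous`), and `f = h ^
(1 / r)` satisfies `‖f x‖ = φ (|x| ^ r) ^ (1 / r)` in `L_r` (`exists_weight_of_functional`).

Now `q (T x) ≤ ‖f x‖`, so for linear `T` the map `f x ↦ T x` is a well defined contraction, which
extends to the closure of `{f x}` because `F` is complete. This closure contains every `L_r`
function carried by `{f ≠ 0}` (`indicatorLp_mem_closure_range_mulLp`), so restriction to `{f ≠ 0}`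
followed by the extension is the required `R` (`exists_factorization_of_le_norm`). -/

noncomputable section

/-! ### Hahn-Banach for cones -/

/-- A relation `D` between vectors and real numbers that is a nonempty-valued convex cone,
bounded below over each vector, has a linear minorant. -/
theorem exists_linearMap_le_of_cone {E : Type*} [AddCommGroup E] [Module ℝ E] (D : E → Set ℝ)
    (hne : ∀ y, (D y).Nonempty) (hbdd : ∀ y, BddBelow (D y))
    (hadd : ∀ y z a b, a ∈ D y → b ∈ D z → a + b ∈ D (y + z))
    (hsmul : ∀ c : ℝ, 0 < c → ∀ y a, a ∈ D y → c * a ∈ D (c • y)) :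
    ∃ φ : E →ₗ[ℝ] ℝ, ∀ y, ∀ a ∈ D y, φ y ≤ a := by
  have hle : ∀ c : ℝ, 0 < c → ∀ y, sInf (D (c • y)) ≤ c * sInf (D y) := by
    intro c hc y
    rw [← div_le_iff₀' hc]
    refine le_csInf (hne y) fun a ha => ?_
    rw [div_le_iff₀' hc]
    exact csInf_le (hbdd _) (hsmul c hc y a ha)
  have hhom : ∀ c : ℝ, 0 < c → ∀ y, sInf (D (c • y)) = c * sInf (D y) := by
    intro c hc y
    refine le_antisymm (hle c hc y) ?_
    have h := hle c⁻¹ (inv_pos.2 hc) (c • y)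
    rw [inv_smul_smul₀ hc.ne'] at h
    calc c * sInf (D y) ≤ c * (c⁻¹ * sInf (D (c • y))) := mul_le_mul_of_nonneg_left h hc.le
      _ = sInf (D (c • y)) := mul_inv_cancel_left₀ hc.ne' _
  have hzero : sInf (D 0) = 0 := by
    have h := hhom 2 (by norm_num) 0
    rw [smul_zero] at h
    linarith
  -- The infimum of `D y` is sublinear in `y`; the zero functional on the trivial subspace is
  -- extended below it.
  obtain ⟨φ, -, hφ⟩ := exists_extension_of_le_sublinear (⟨⊥, 0⟩ : E →ₗ.[ℝ] ℝ)
    (fun y => sInf (D y)) hhom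
    (fun y z => by
      rw [← sub_le_iff_le_add]
      refine le_csInf (hne y) fun a ha => ?_
      rw [sub_le_comm]
      refine le_csInf (hne z) fun b hb => ?_
      rw [sub_le_iff_le_add']
      exact csInf_le (hbdd _) (hadd y z a b ha hb))
    (fun x => by
      have hx : (x : E) = 0 := (Submodule.mem_bot ℝ).1 x.2
      rw [hx, hzero]
      simp)
  exact ⟨φ, fun y a ha => (hφ y).trans (csInf_le (hbdd y) ha)⟩

/-! ### Powers and order in `L₀(μ)` -/

section AbsPow

variable {Ω : Type*} [MeasurableSpace Ω] {μ : Measure Ω}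

instance AEEqFun.instIsOrderedAddMonoidReal : IsOrderedAddMonoid (Ω →ₘ[μ] ℝ) where
  add_le_add_left x y h z := by
    rw [← AEEqFun.coeFn_le] at h ⊢
    filter_upwards [h, AEEqFun.coeFn_add x z, AEEqFun.coeFn_add y z] with ω h1 h2 h3
    rw [h2, h3]
    exact add_le_add_left h1 (z ω)

theorem coeFn_absPow_ae (x : Ω →ₘ[μ] ℝ) (r : ℝ) : ∀ᵐ ω ∂μ, absPow x r ω = |x ω| ^ r :=
  QuasiKotheSpace.coeFn_absPow x r

theorem absPow_nonneg (x : Ω →ₘ[μ] ℝ) (r : ℝ) : 0 ≤ absPow x r := by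
  rw [← AEEqFun.coeFn_le]
  filter_upwards [coeFn_absPow_ae x r, AEEqFun.coeFn_zero (μ := μ) (β := ℝ)] with ω h1 h2
  rw [h1, h2]
  exact Real.rpow_nonneg (abs_nonneg _) _

theorem absPow_absPow (x : Ω →ₘ[μ] ℝ) (a b : ℝ) : absPow (absPow x a) b = absPow x (a * b) := by
  refine AEEqFun.ext ?_
  filter_upwards [coeFn_absPow_ae (absPow x a) b, coeFn_absPow_ae x a,
    coeFn_absPow_ae x (a * b)] with ω h1 h2 h3
  rw [h1, h2, h3, abs_of_nonneg (Real.rpow_nonneg (abs_nonneg _) _),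
    ← Real.rpow_mul (abs_nonneg _)]

theorem absPow_one (x : Ω →ₘ[μ] ℝ) : absPow x 1 = |x| := by
  refine AEEqFun.ext ?_
  filter_upwards [coeFn_absPow_ae x 1, AEEqFun.coeFn_abs x] with ω h1 h2
  rw [h1, h2, Real.rpow_one]

theorem abs_absPow (x : Ω →ₘ[μ] ℝ) (r : ℝ) : |absPow x r| = absPow x r :=
  abs_of_nonneg (absPow_nonneg x r)

theorem absPow_mono {x y : Ω →ₘ[μ] ℝ} (h : |x| ≤ |y|) {r : ℝ} (hr : 0 ≤ r) :
    absPow x r ≤ absPow y r := by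
  rw [← AEEqFun.coeFn_le] at h ⊢
  filter_upwards [h, coeFn_absPow_ae x r, coeFn_absPow_ae y r, AEEqFun.coeFn_abs x,
    AEEqFun.coeFn_abs y] with ω h1 h2 h3 h4 h5
  rw [h4, h5] at h1
  rw [h2, h3]
  exact Real.rpow_le_rpow (abs_nonneg _) h1 hr

theorem absPow_smul (c : ℝ) (x : Ω →ₘ[μ] ℝ) (r : ℝ) :
    absPow (c • x) r = |c| ^ r • absPow x r := by
  refine AEEqFun.ext ?_
  filter_upwards [coeFn_absPow_ae (c • x) r, coeFn_absPow_ae x r, AEEqFun.coeFn_smul c x,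
    AEEqFun.coeFn_smul (|c| ^ r) (absPow x r)] with ω h1 h2 h3 h4
  rw [h1, h3, h4, Pi.smul_apply, Pi.smul_apply, h2, smul_eq_mul, smul_eq_mul, abs_mul,
    Real.mul_rpow (abs_nonneg _) (abs_nonneg _)]

end AbsPow

/-! ### Domination by a positive functional on `X^r` -/

namespace QuasiKotheSpace

variable {Ω : Type*} [MeasurableSpace Ω] {μ : Measure Ω} (X : QuasiKotheSpace μ)

theorem nrm_nonneg (x : X.carrier) : 0 ≤ X.nrm x := X.isQuasiNorm.nonneg x

theorem nrm_smul (c : ℝ) (x : X.carrier) : X.nrm (c • x) = |c| * X.nrm x :=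
  X.isQuasiNorm.smul c x

/-- The best constant is attained: each defining inequality is a closed condition on `c`. -/
theorem convexityConst_mem {r : ℝ} (h : X.IsConvex r) :
    X.convexityConst r ∈ X.convexityBounds r := by
  refine IsClosed.csInf_mem ?_ h ⟨0, fun c hc => hc.1⟩
  simp only [convexityBounds, Set.ofPred_and, Set.ofPred_forall]
  refine IsClosed.inter isClosed_Ici (isClosed_iInter fun n => isClosed_iInter fun x =>
    isClosed_iInter fun _ => isClosed_le (by fun_prop) (by fun_prop))

theorem concavityConst_mem {F : Type*} {q : F → ℝ} {T : X.carrier → F} {r : ℝ}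
    (h : X.IsConcaveMap q T r) : X.concavityConst q T r ∈ X.concavityBounds q T r := by
  refine IsClosed.csInf_mem ?_ h ⟨0, fun c hc => hc.1⟩
  simp only [concavityBounds, Set.ofPred_and, Set.ofPred_forall]
  refine IsClosed.inter isClosed_Ici (isClosed_iInter fun n => isClosed_iInter fun x =>
    isClosed_le (by fun_prop) (by fun_prop))

variable {r : ℝ} (hr : 0 < r)

/-- The element `|y| ^ (1 / r)` of `X(μ)`, for `y ∈ X^r(μ)`. -/
def root (y : X.power r hr) : X.carrier := ⟨absPow (y : Ω →ₘ[μ] ℝ) (1 / r), y.2⟩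

theorem coe_toPower (x : X.carrier) :
    (X.toPower hr x : Ω →ₘ[μ] ℝ) = absPow (x : Ω →ₘ[μ] ℝ) r := rfl

theorem coe_root (y : X.power r hr) :
    (X.root hr y : Ω →ₘ[μ] ℝ) = absPow (y : Ω →ₘ[μ] ℝ) (1 / r) := rfl

theorem coe_toPower_root (y : X.power r hr) :
    (X.toPower hr (X.root hr y) : Ω →ₘ[μ] ℝ) = |(y : Ω →ₘ[μ] ℝ)| := by
  rw [coe_toPower, coe_root, absPow_absPow, one_div_mul_cancel hr.ne', absPow_one]

theorem toPower_root {y : X.power r hr} (hy : 0 ≤ (y : Ω →ₘ[μ] ℝ)) :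
    X.toPower hr (X.root hr y) = y :=
  Subtype.ext (by rw [coe_toPower_root, abs_of_nonneg hy])

theorem toPower_nonneg (x : X.carrier) : 0 ≤ (X.toPower hr x : Ω →ₘ[μ] ℝ) := absPow_nonneg _ _

theorem toPower_smul (c : ℝ) (x : X.carrier) :
    X.toPower hr (c • x) = |c| ^ r • X.toPower hr x :=
  Subtype.ext (absPow_smul c _ r)

theorem nrm_root_mono {y z : X.power r hr} (h : |(y : Ω →ₘ[μ] ℝ)| ≤ |(z : Ω →ₘ[μ] ℝ)|) :
    X.nrm (X.root hr y) ≤ X.nrm (X.root hr z) := by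
  refine X.solid_norm _ _ (X.root hr z).2 ?_
  rw [coe_root, coe_root, abs_absPow, abs_absPow]
  exact absPow_mono h (one_div_pos.2 hr).le

/-- `∑ |x| ^ r` over the members of a list in `X(μ)`. -/
def listPowSum (L : List X.carrier) : X.power r hr := (L.map (X.toPower hr)).sum

theorem listPowSum_cons (x : X.carrier) (L : List X.carrier) :
    X.listPowSum hr (x :: L) = X.toPower hr x + X.listPowSum hr L := by
  simp [listPowSum]

theorem listPowSum_append (L L' : List X.carrier) :
    X.listPowSum hr (L ++ L') = X.listPowSum hr L + X.listPowSum hr L' := by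
  simp [listPowSum]

theorem listPowSum_map_smul (c : ℝ) (L : List X.carrier) :
    X.listPowSum hr (L.map fun x => c • x) = |c| ^ r • X.listPowSum hr L := by
  induction L with
  | nil => simp [listPowSum]
  | cons x L ih => rw [List.map_cons, listPowSum_cons, listPowSum_cons, ih, toPower_smul, smul_add]

theorem listPowSum_nonneg (L : List X.carrier) :
    0 ≤ (X.listPowSum hr L : Ω →ₘ[μ] ℝ) := by
  induction L with
  | nil => simp [listPowSum]
  | cons x L ih =>
    rw [listPowSum_cons, Submodule.coe_add]
    exact add_nonneg (X.toPower_nonneg hr x) ih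

/-- Links the `Fin`-indexed families of the definitions to lists, where adding two sums of powers is
just concatenation. -/
theorem powSum_getElem (L : List X.carrier) :
    powSum r (fun k : Fin L.length => (L[k.1] : Ω →ₘ[μ] ℝ)) =
      X.root hr (X.listPowSum hr L) := by
  rw [powSum, Fin.sum_univ_fun_getElem L (fun x : X.carrier => absPow (x : Ω →ₘ[μ] ℝ) r),
    coe_root, listPowSum]
  congr 1
  induction L with
  | nil => simp
  | cons x L ih => simp [coe_toPower]

theorem nrm_root_listPowSum_rpow_le (hconv : X.IsConvex r) (L : List X.carrier) :
    X.nrm (X.root hr (X.listPowSum hr L)) ^ r ≤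
      X.convexityConst r ^ r * (L.map fun x => X.nrm x ^ r).sum := by
  obtain ⟨h0, h⟩ := X.convexityConst_mem hconv
  have h1 := h L.length (fun k => L[k.1]) (fun k => L[k.1].2)
  rw [powSum_getElem X hr,
    Fin.sum_univ_fun_getElem L (fun x : X.carrier => X.qnorm (x : Ω →ₘ[μ] ℝ) ^ r)] at h1
  have hs : 0 ≤ (L.map fun x => X.nrm x ^ r).sum :=
    List.sum_nonneg fun a ha => by
      obtain ⟨x, -, rfl⟩ := List.mem_map.1 ha
      exact Real.rpow_nonneg (X.nrm_nonneg x) r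
  calc X.nrm (X.root hr (X.listPowSum hr L)) ^ r
      ≤ (X.convexityConst r * (L.map fun x => X.nrm x ^ r).sum ^ (1 / r)) ^ r :=
        Real.rpow_le_rpow (X.nrm_nonneg _) h1 hr.le
    _ = _ := by
        rw [Real.mul_rpow h0 (Real.rpow_nonneg hs _), ← Real.rpow_mul hs,
          one_div_mul_cancel hr.ne', Real.rpow_one]

theorem sum_rpow_le_nrm_root {F : Type*} {q : F → ℝ} (hq : ∀ z, 0 ≤ q z) {T : X.carrier → F}
    (hT : X.IsConcaveMap q T r) (L : List X.carrier) :
    (L.map fun x => q (T x) ^ r).sum ≤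
      X.concavityConst q T r ^ r * X.nrm (X.root hr (X.listPowSum hr L)) ^ r := by
  obtain ⟨h0, h⟩ := X.concavityConst_mem hT
  have h1 := h L.length (fun k => L[k.1])
  rw [powSum_getElem X hr,
    Fin.sum_univ_fun_getElem L (fun x : X.carrier => q (T x) ^ r)] at h1
  have hs : 0 ≤ (L.map fun x => q (T x) ^ r).sum :=
    List.sum_nonneg fun a ha => by
      obtain ⟨x, -, rfl⟩ := List.mem_map.1 ha
      exact Real.rpow_nonneg (hq _) r
  rw [← Real.mul_rpow h0 (X.nrm_nonneg _)]
  calc (L.map fun x => q (T x) ^ r).sum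
      = ((L.map fun x => q (T x) ^ r).sum ^ (1 / r)) ^ r := by
        rw [← Real.rpow_mul hs, one_div_mul_cancel hr.ne', Real.rpow_one]
    _ ≤ _ := Real.rpow_le_rpow (Real.rpow_nonneg hs _) h1 hr.le

/-- Maurey's domination of an `r`-concave homogeneous map by a positive linear functional. -/
theorem exists_dominating_functional {F : Type*} [AddCommGroup F] [Module ℝ F] {q : F → ℝ}
    (hq : IsQuasiNorm q) (hconv : X.IsConvex r) {T : X.carrier → F}
    (hhom : ∀ c : ℝ, 0 ≤ c → ∀ x, T (c • x) = c • T x) (hT : X.IsConcaveMap q T r) :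
    ∃ φ : X.power r hr →ₗ[ℝ] ℝ,
      (∀ y : X.power r hr, 0 ≤ (y : Ω →ₘ[μ] ℝ) → 0 ≤ φ y) ∧
      (∀ x, φ (X.toPower hr x) ≤ (X.concavityConst q T r * X.convexityConst r * X.nrm x) ^ r) ∧
      ∀ x, q (T x) ^ r ≤ φ (X.toPower hr x) := by
  have hA := (X.concavityConst_mem hT).1
  have hB := (X.convexityConst_mem hconv).1
  set A := X.concavityConst q T r
  set B := X.convexityConst r
  set N : List X.carrier → ℝ := fun L => (L.map fun x => X.nrm x ^ r).sum with hN
  set Q : List X.carrier → ℝ := fun L => (L.map fun x => q (T x) ^ r).sum with hQ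
  -- All upper bounds for `φ y` forced by positivity and the two desired inequalities: `L` collects
  -- uses of the upper one, `L'` uses of the lower one.
  let D : X.power r hr → Set ℝ := fun y => {a | ∃ L L' : List X.carrier,
    (y : Ω →ₘ[μ] ℝ) + X.listPowSum hr L' ≤ X.listPowSum hr L ∧ a = A ^ r * B ^ r * N L - Q L'}
  -- From `y + ∑_L' |x| ^ r ≤ ∑_L |x| ^ r` follows `∑_L' |x| ^ r ≤ |y| + ∑_L |x| ^ r`. Concavity
  -- bounds `Q L'` by the norm of the left side, and convexity, applied to `L` with `|y| ^ (1 / r)`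
  -- adjoined, bounds the right side.
  have hbound : ∀ y : X.power r hr, ∀ a ∈ D y, -(A ^ r * B ^ r * X.nrm (X.root hr y) ^ r) ≤ a := by
    rintro y _ ⟨L, L', h, rfl⟩
    have h1 := X.sum_rpow_le_nrm_root hr hq.nonneg hT L'
    have h2 := X.nrm_root_listPowSum_rpow_le hr hconv (X.root hr y :: L)
    have h3 : X.nrm (X.root hr (X.listPowSum hr L')) ≤
        X.nrm (X.root hr (X.listPowSum hr (X.root hr y :: L))) := by
      refine X.nrm_root_mono hr ?_
      rw [abs_of_nonneg (X.listPowSum_nonneg hr _), abs_of_nonneg (X.listPowSum_nonneg hr _),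
        listPowSum_cons, Submodule.coe_add, coe_toPower_root]
      calc (X.listPowSum hr L' : Ω →ₘ[μ] ℝ)
          = -(y : Ω →ₘ[μ] ℝ) + ((y : Ω →ₘ[μ] ℝ) + X.listPowSum hr L') := by abel
        _ ≤ _ := add_le_add (neg_le_abs _) h
    have h4 := Real.rpow_le_rpow (X.nrm_nonneg _) h3 hr.le
    rw [List.map_cons, List.sum_cons] at h2
    have h5 := mul_le_mul_of_nonneg_left (h4.trans h2) (Real.rpow_nonneg hA r)
    simp only [hN, hQ]
    linarith
  obtain ⟨φ, hφ⟩ := exists_linearMap_le_of_cone D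
    -- Nonempty because `y ≤ |y| = (|y| ^ (1 / r)) ^ r`.
    (fun y => ⟨_, [X.root hr y], [], by
      rw [listPowSum_cons, Submodule.coe_add, coe_toPower_root]
      simpa [listPowSum] using le_abs_self (y : Ω →ₘ[μ] ℝ), rfl⟩)
    (fun y => ⟨_, fun a ha => hbound y a ha⟩)
    (by
      rintro y z _ _ ⟨L, L', h, rfl⟩ ⟨K, K', h', rfl⟩
      refine ⟨L ++ K, L' ++ K', ?_, ?_⟩
      · rw [listPowSum_append, listPowSum_append, Submodule.coe_add, Submodule.coe_add,
          Submodule.coe_add, add_add_add_comm]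
        exact add_le_add h h'
      · simp only [hN, hQ, List.map_append, List.sum_append]
        ring)
    (by
      rintro c hc y _ ⟨L, L', h, rfl⟩
      have hc' : 0 ≤ c ^ (1 / r) := Real.rpow_nonneg hc.le _
      have hcr : (c ^ (1 / r)) ^ r = c := by
        rw [← Real.rpow_mul hc.le, one_div_mul_cancel hr.ne', Real.rpow_one]
      -- Scaling by `c ^ (1 / r)` multiplies each of the `r`-th powers by `c`; for `Q` this uses the
      -- positive homogeneity of `T`.
      refine ⟨L.map fun x => c ^ (1 / r) • x, L'.map fun x => c ^ (1 / r) • x, ?_, ?_⟩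
      · rw [listPowSum_map_smul, listPowSum_map_smul, abs_of_nonneg hc', hcr]
        simp only [Submodule.coe_smul]
        rw [← smul_add]
        rw [← AEEqFun.coeFn_le] at h ⊢
        filter_upwards [h, AEEqFun.coeFn_smul c ((y : Ω →ₘ[μ] ℝ) + (X.listPowSum hr L' : Ω →ₘ[μ] ℝ)),
          AEEqFun.coeFn_smul c (X.listPowSum hr L : Ω →ₘ[μ] ℝ)] with ω h1 h2 h3
        rw [h2, h3]
        exact mul_le_mul_of_nonneg_left h1 hc.le
      · have e1 : ∀ L, N (L.map fun x => c ^ (1 / r) • x) = c * N L := by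
          intro L
          simp only [hN, List.map_map, ← List.sum_map_mul_left]
          congr 1
          refine List.map_congr_left fun x _ => ?_
          rw [Function.comp_apply, nrm_smul, abs_of_nonneg hc',
            Real.mul_rpow hc' (X.nrm_nonneg x), hcr]
        have e2 : ∀ L, Q (L.map fun x => c ^ (1 / r) • x) = c * Q L := by
          intro L
          simp only [hQ, List.map_map, ← List.sum_map_mul_left]
          congr 1
          refine List.map_congr_left fun x _ => ?_
          rw [Function.comp_apply, hhom _ hc', hq.smul, abs_of_nonneg hc',
            Real.mul_rpow hc' (hq.nonneg _), hcr]
        rw [e1, e2]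
        ring)
  refine ⟨φ, fun y hy => ?_, fun x => ?_, fun x => ?_⟩
  -- Two empty lists show that `φ (-y) ≤ 0` for `y ≥ 0`.
  · have h := hφ (-y) 0 ⟨[], [], by simpa [listPowSum] using hy, by simp [hN, hQ]⟩
    rw [map_neg] at h
    linarith
  · refine hφ _ _ ⟨[x], [], by simp [listPowSum], ?_⟩
    rw [Real.mul_rpow (mul_nonneg hA hB) (X.nrm_nonneg x), Real.mul_rpow hA hB]
    simp [hN, hQ]
  -- The lower bound for `φ (|x| ^ r)` is an upper bound at `-|x| ^ r`, with `L` empty and `L' =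
  -- [x]`.
  · have h := hφ (-X.toPower hr x) (-q (T x) ^ r)
      ⟨[], [x], by simp [listPowSum], by simp [hN, hQ]⟩
    rw [map_neg] at h
    linarith

end QuasiKotheSpace

end

/-! ### Extension of a dominated operator by density -/

noncomputable section

section Extension

variable {F : Type*} [AddCommGroup F] [Module ℝ F] {q : F → ℝ}

theorem IsQuasiNorm.neg (hq : IsQuasiNorm q) (x : F) : q (-x) = q x := by
  have h := hq.smul (-1) x
  simpa using h

theorem IsQuasiNorm.sub_comm (hq : IsQuasiNorm q) (x y : F) : q (x - y) = q (y - x) := by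
  rw [← hq.neg, neg_sub]

theorem IsQuasiNorm.tendsto_add (hq : IsQuasiNorm q) {u v : ℕ → F}
    (hu : Tendsto (fun n => q (u n)) atTop (𝓝 0)) (hv : Tendsto (fun n => q (v n)) atTop (𝓝 0)) :
    Tendsto (fun n => q (u n + v n)) atTop (𝓝 0) := by
  obtain ⟨K, hK⟩ := hq.quasi_triangle
  refine squeeze_zero (fun n => hq.nonneg _) (fun n => hK (u n) (v n)) ?_
  simpa using (hu.add hv).const_mul K

/-- Since `x - y = (x - u n) + (u n - v n) + (v n - y)`, the constant `q (x - y)` tends to `0`.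
Continuity of `q` is not needed. -/
theorem IsQuasiNorm.eq_of_tendsto (hq : IsQuasiNorm q) {u v : ℕ → F} {x y : F}
    (hu : Tendsto (fun n => q (u n - x)) atTop (𝓝 0))
    (hv : Tendsto (fun n => q (v n - y)) atTop (𝓝 0))
    (huv : Tendsto (fun n => q (u n - v n)) atTop (𝓝 0)) : x = y := by
  have h1 : Tendsto (fun n => q (x - u n)) atTop (𝓝 0) := by simpa only [hq.sub_comm x] using hu
  have h := hq.tendsto_add (hq.tendsto_add h1 huv) hv
  simp only [sub_add_sub_cancel] at h
  exact sub_eq_zero.1 (hq.eq_zero _ (tendsto_nhds_unique tendsto_const_nhds h))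

variable {V : Type*} [AddCommGroup V] [Module ℝ V] {E : Type*} [NormedAddCommGroup E]
  [NormedSpace ℝ E]

/-- A linear map `T` dominated by `‖M ·‖` factors through `M`, with the second factor defined on
the whole space if a contraction onto the closure of the range of `M` is given. -/
theorem exists_factorization_of_le_norm (hq : IsQuasiBanachNorm q) (T : V →ₗ[ℝ] F)
    (M : V →ₗ[ℝ] E) (hTM : ∀ x, q (T x) ≤ ‖M x‖) (P : E →ₗ[ℝ] E) (hP : ∀ g, ‖P g‖ ≤ ‖g‖)
    (hPM : ∀ x, P (M x) = M x) (hcl : ∀ g, P g ∈ closure (Set.range M)) :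
    ∃ R : E →ₗ[ℝ] F, (∀ x, R (M x) = T x) ∧ IsBoundedFor (fun g => ‖g‖) q R ∧
      (IsContinuousFor q → ∀ g, q (R g) ≤ ‖g‖) := by
  have hqn := hq.toIsQuasiNorm
  -- `R g` is to be the limit of `T (x n)` along a sequence with `M (x n) → P g`; the domination by
  -- `‖M ·‖` makes `T (x n)` Cauchy.
  have hex : ∀ g, ∃ z, ∃ x : ℕ → V, Tendsto (fun n => M (x n)) atTop (𝓝 (P g)) ∧
      Tendsto (fun n => q (T (x n) - z)) atTop (𝓝 0) := by
    intro g
    obtain ⟨w, hw, hlim⟩ := mem_closure_iff_seq_limit.1 (hcl g)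
    choose x hx using hw
    have hxlim : Tendsto (fun n => M (x n)) atTop (𝓝 (P g)) := by simpa only [hx] using hlim
    obtain ⟨z, hz⟩ := hq.complete (fun n => T (x n)) fun ε hε => by
      obtain ⟨N, hN⟩ := Metric.cauchySeq_iff.1 hxlim.cauchySeq ε hε
      refine ⟨N, fun m hm n hn => ?_⟩
      rw [← map_sub]
      refine (hTM _).trans_lt ?_
      rw [map_sub, ← dist_eq_norm]
      exact hN m hm n hn
    exact ⟨z, x, hxlim, hz⟩
  choose R x hxM hxT using hex
  -- The limit does not depend on the sequence. Linearity of `R` and `R ∘ M = T` follow by choosing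
  -- suitable sequences.
  have huniq : ∀ g z (y : ℕ → V), Tendsto (fun n => M (y n)) atTop (𝓝 (P g)) →
      Tendsto (fun n => q (T (y n) - z)) atTop (𝓝 0) → R g = z := by
    intro g z y hy hz
    refine hqn.eq_of_tendsto (hxT g) hz ?_
    refine squeeze_zero (g := fun n => ‖M (x g n) - M (y n)‖) (fun n => hqn.nonneg _)
      (fun n => by simpa only [map_sub] using hTM (x g n - y n)) ?_
    simpa using ((hxM g).sub hy).norm
  let R' : E →ₗ[ℝ] F :=
    { toFun := R
      map_add' := fun g g' => huniq _ _ (fun n => x g n + x g' n)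
        (by simpa only [map_add] using (hxM g).add (hxM g'))
        (by simpa only [map_add, add_sub_add_comm] using hqn.tendsto_add (hxT g) (hxT g'))
      map_smul' := fun c g => huniq _ _ (fun n => c • x g n)
        (by simpa only [map_smul] using (hxM g).const_smul c)
        (by simpa [← smul_sub, hqn.smul] using (hxT g).const_mul |c|) }
  refine ⟨R', fun y => huniq _ _ (fun _ => y) ?_ ?_, ?_, fun hc g => ?_⟩
  · rw [hPM]
    exact tendsto_const_nhds
  · have h0 : q 0 = 0 := by simpa using hqn.smul 0 0
    simp [h0]
  -- As `q` may be discontinuous, the bound passes to the limit only up to the quasi triangle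
  -- constant, taken as `|K|` since no sign of `K` is prescribed.
  · obtain ⟨K, hK⟩ := hqn.quasi_triangle
    refine ⟨|K|, abs_nonneg K, fun g => ?_⟩
    have h1 : ∀ n, q (R g) ≤ |K| * (q (T (x g n) - R g) + ‖M (x g n)‖) := by
      intro n
      have h2 := hK (R g - T (x g n)) (T (x g n))
      rw [sub_add_cancel, hqn.sub_comm] at h2
      have h3 := hqn.nonneg (T (x g n) - R g)
      have h4 := hqn.nonneg (T (x g n))
      calc q (R g) ≤ K * (q (T (x g n) - R g) + q (T (x g n))) := h2
        _ ≤ |K| * (q (T (x g n) - R g) + q (T (x g n))) :=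
          mul_le_mul_of_nonneg_right (le_abs_self K) (by positivity)
        _ ≤ _ := mul_le_mul_of_nonneg_left (add_le_add_right (hTM _) _) (abs_nonneg K)
    have h5 := ge_of_tendsto' (((hxT g).add (hxM g).norm).const_mul |K|) h1
    rw [zero_add] at h5
    exact h5.trans (mul_le_mul_of_nonneg_left (hP g) (abs_nonneg K))
  · exact (le_of_tendsto_of_tendsto' (hc _ _ (hxT g)) (hxM g).norm fun n => hTM _).trans (hP g)

end Extension

end

/-! ### Integral representation of order continuous functionals -/

noncomputable section

section IntegralRepresentation

open scoped ENNReal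

variable {Ω : Type*} [MeasurableSpace Ω] {μ : Measure Ω}

open Classical in
/-- The class of the indicator function of a measurable set (and `0` for other sets). -/
def indClass (μ : Measure Ω) (s : Set Ω) : Ω →ₘ[μ] ℝ :=
  if hs : MeasurableSet s then
    AEEqFun.mk (s.indicator fun _ => (1 : ℝ)) (measurable_const.indicator hs).aestronglyMeasurable
  else 0

theorem coeFn_indClass {s : Set Ω} (hs : MeasurableSet s) :
    ∀ᵐ ω ∂μ, indClass μ s ω = s.indicator (fun _ => (1 : ℝ)) ω := by
  rw [indClass, dif_pos hs]
  exact AEEqFun.coeFn_mk _ _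

theorem aeeqFun_nonneg_iff {x : Ω →ₘ[μ] ℝ} : 0 ≤ x ↔ ∀ᵐ ω ∂μ, 0 ≤ x ω := by
  rw [← AEEqFun.coeFn_le]
  constructor
  · intro h
    filter_upwards [h, AEEqFun.coeFn_zero (μ := μ) (β := ℝ)] with ω h1 h2
    rwa [h2] at h1
  · intro h
    filter_upwards [h, AEEqFun.coeFn_zero (μ := μ) (β := ℝ)] with ω h1 h2
    rwa [h2]

theorem aeeqFun_abs_le_iff {x y : Ω →ₘ[μ] ℝ} : |x| ≤ |y| ↔ ∀ᵐ ω ∂μ, |x ω| ≤ |y ω| := by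
  rw [← AEEqFun.coeFn_le]
  constructor
  · intro h
    filter_upwards [h, AEEqFun.coeFn_abs x, AEEqFun.coeFn_abs y] with ω h1 h2 h3
    rwa [h2, h3] at h1
  · intro h
    filter_upwards [h, AEEqFun.coeFn_abs x, AEEqFun.coeFn_abs y] with ω h1 h2 h3
    rwa [h2, h3]

theorem indClass_nonneg {s : Set Ω} (hs : MeasurableSet s) : 0 ≤ indClass μ s := by
  rw [aeeqFun_nonneg_iff]
  filter_upwards [coeFn_indClass hs] with ω h
  rw [h]
  exact Set.indicator_nonneg (fun _ _ => zero_le_one) ω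

theorem indClass_eq_zero {s : Set Ω} (hs : MeasurableSet s) (h0 : μ s = 0) :
    indClass μ s = 0 := by
  refine AEEqFun.ext ?_
  filter_upwards [coeFn_indClass hs, AEEqFun.coeFn_zero (μ := μ) (β := ℝ),
    measure_eq_zero_iff_ae_notMem.1 h0] with ω h1 h2 h3
  rw [h1, h2, Set.indicator_of_notMem h3]
  rfl

theorem indClass_union {s t : Set Ω} (hs : MeasurableSet s) (ht : MeasurableSet t)
    (hst : Disjoint s t) : indClass μ (s ∪ t) = indClass μ s + indClass μ t := by
  refine AEEqFun.ext ?_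
  filter_upwards [coeFn_indClass hs, coeFn_indClass ht, coeFn_indClass (hs.union ht),
    AEEqFun.coeFn_add (indClass μ s) (indClass μ t)] with ω h1 h2 h3 h4
  rw [h3, h4, Pi.add_apply, h1, h2, Set.indicator_union_of_disjoint hst]

/-- A linear subspace of `L₀(μ)` is solid if it contains each function dominated by one of its
elements. -/
def IsSolidSubspace (W : Submodule ℝ (Ω →ₘ[μ] ℝ)) : Prop :=
  ∀ x y : Ω →ₘ[μ] ℝ, y ∈ W → |x| ≤ |y| → x ∈ W

/-- Only null sets are disjoint from the supports of all elements of `W`. -/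
def HasFullSupport (W : Submodule ℝ (Ω →ₘ[μ] ℝ)) : Prop :=
  ∀ A : Set Ω, MeasurableSet A → (∀ x ∈ W, ∀ᵐ ω ∂μ, ω ∈ A → x ω = 0) → μ A = 0

variable {W : Submodule ℝ (Ω →ₘ[μ] ℝ)}

theorem IsSolidSubspace.mem_of_ae (hW : IsSolidSubspace W) {x y : Ω →ₘ[μ] ℝ} (hy : y ∈ W)
    (h : ∀ᵐ ω ∂μ, |x ω| ≤ |y ω|) : x ∈ W :=
  hW x y hy (aeeqFun_abs_le_iff.2 h)

theorem IsSolidSubspace.mem_of_le (hW : IsSolidSubspace W) {x y : Ω →ₘ[μ] ℝ} (hy : y ∈ W)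
    (h0 : 0 ≤ x) (h : x ≤ y) : x ∈ W :=
  hW x y hy (by rwa [abs_of_nonneg h0, abs_of_nonneg (h0.trans h)])

theorem IsSolidSubspace.indClass_mem_of_subset (hW : IsSolidSubspace W) {s t : Set Ω}
    (hs : MeasurableSet s) (ht : MeasurableSet t) (hst : s ⊆ t) (h : indClass μ t ∈ W) :
    indClass μ s ∈ W := by
  refine hW.mem_of_ae h ?_
  filter_upwards [coeFn_indClass hs, coeFn_indClass ht] with ω h1 h2
  rw [h1, h2, abs_of_nonneg (Set.indicator_nonneg (fun _ _ => zero_le_one) ω),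
    abs_of_nonneg (Set.indicator_nonneg (fun _ _ => zero_le_one) ω)]
  exact Set.indicator_le_indicator_of_subset hst (fun _ => zero_le_one) ω

theorem IsSolidSubspace.indClass_union_mem (hW : IsSolidSubspace W) {s t : Set Ω}
    (hs : MeasurableSet s) (ht : MeasurableSet t) (h : indClass μ s ∈ W)
    (h' : indClass μ t ∈ W) : indClass μ (s ∪ t) ∈ W := by
  rw [← Set.union_sdiff_self, indClass_union hs (ht.diff hs) Set.disjoint_sdiff_right]
  exact W.add_mem h (hW.indClass_mem_of_subset (ht.diff hs) ht Set.sdiff_subset h')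

/-- The underlying space is exhausted by sets whose indicator functions belong to `W`. -/
theorem exists_exhausting_indClass_mem [SFinite μ] (hW : IsSolidSubspace W)
    (hfull : HasFullSupport W) :
    ∃ A : ℕ → Set Ω, Monotone A ∧ (∀ n, MeasurableSet (A n)) ∧ (∀ n, indClass μ (A n) ∈ W) ∧
      ∀ᵐ ω ∂μ, ∃ n, ω ∈ A n := by
  -- A finite measure with the null sets of `μ`, so that the supremum of `P` over `C` is finite and
  -- can be used for exhaustion.
  set P := μ.toFinite with hP
  let C : Set (Set Ω) := {s | MeasurableSet s ∧ indClass μ s ∈ W}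
  have hCne : (∅ : Set Ω) ∈ C :=
    ⟨MeasurableSet.empty, by rw [indClass_eq_zero MeasurableSet.empty measure_empty]; exact W.zero_mem⟩
  obtain ⟨u, -, hu, huC⟩ := exists_seq_tendsto_sSup (S := P '' C) ⟨_, _, hCne, rfl⟩
    (OrderTop.bddAbove _)
  choose B hBC hBu using huC
  have hacc : ∀ n, Set.accumulate B n ∈ C := by
    intro n
    induction n with
    | zero => simpa using hBC 0
    | succ n ih =>
      rw [Set.accumulate_succ]
      exact ⟨ih.1.union (hBC _).1, hW.indClass_union_mem ih.1 (hBC _).1 ih.2 (hBC _).2⟩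
  set S := sSup (P '' C) with hS
  have hle : ∀ s ∈ C, P s ≤ S := fun s hs => le_sSup ⟨s, hs, rfl⟩
  have hStop : S ≠ ∞ := ne_top_of_le_ne_top (measure_ne_top P Set.univ)
    (sSup_le (by rintro _ ⟨s, -, rfl⟩; exact measure_mono (Set.subset_univ s)))
  have hlim : Tendsto (fun n => P (Set.accumulate B n)) atTop (𝓝 S) :=
    tendsto_of_tendsto_of_tendsto_of_le_of_le hu tendsto_const_nhds
      (fun n => by
        rw [← hBu]
        exact measure_mono (Set.subset_accumulate))
      (fun n => hle _ (hacc n))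
  refine ⟨Set.accumulate B, Set.monotone_accumulate, fun n => (hacc n).1, fun n => (hacc n).2, ?_⟩
  set U := ⋃ n, Set.accumulate B n with hU
  have hUm : MeasurableSet U := MeasurableSet.iUnion fun n => (hacc n).1
  -- For `x ∈ W`, the part of `{|x| > 1 / (k + 1)}` outside `U` lies in `C`. Adjoining it to the
  -- maximizing sets cannot exceed the supremum `S`, so it is null. Thus every `x ∈ W` vanishes a.e.
  -- off `U`, and full support applies.
  have hnull : μ Uᶜ = 0 := by
    refine hfull _ hUm.compl fun x hx => ?_
    have hk : ∀ k : ℕ, ∀ᵐ ω ∂μ, ω ∉ {ω | 1 / ((k : ℝ) + 1) < |x ω|} ∩ Uᶜ := by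
      intro k
      set D := {ω | 1 / ((k : ℝ) + 1) < |x ω|} ∩ Uᶜ with hD
      have hDm : MeasurableSet D :=
        (measurableSet_lt measurable_const (measurable_norm.comp x.measurable)).inter hUm.compl
      have hDC : D ∈ C := by
        refine ⟨hDm, hW.mem_of_ae (W.smul_mem ((k : ℝ) + 1) hx) ?_⟩
        filter_upwards [coeFn_indClass hDm, AEEqFun.coeFn_smul ((k : ℝ) + 1) x] with ω h1 h2
        rw [h1, h2, Pi.smul_apply, smul_eq_mul]
        by_cases hω : ω ∈ D
        · rw [Set.indicator_of_mem hω, abs_one, abs_mul, abs_of_pos (by positivity)]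
          have := hω.1
          simp only [Set.mem_ofPred_eq] at this
          rw [div_lt_iff₀' (by positivity)] at this
          exact this.le
        · rw [Set.indicator_of_notMem hω, abs_zero]
          exact abs_nonneg _
      have hadd : ∀ n, P (Set.accumulate B n) + P D ≤ S := by
        intro n
        rw [← measure_union _ hDm]
        · exact hle _ ⟨(hacc n).1.union hDm,
            hW.indClass_union_mem (hacc n).1 hDm (hacc n).2 hDC.2⟩
        · refine Set.disjoint_left.2 fun ω h1 h2 => h2.2 (Set.mem_iUnion.2 ⟨n, h1⟩)
      have hPD : P D = 0 := by
        have h := le_of_tendsto' (hlim.add_const (P D)) hadd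
        by_contra h0
        exact (ENNReal.lt_add_right hStop h0).not_ge h
      exact measure_eq_zero_iff_ae_notMem.1 (absolutelyContinuous_toFinite μ hPD)
    filter_upwards [ae_all_iff.2 hk] with ω hω hωU
    by_contra hne
    obtain ⟨k, hk⟩ := exists_nat_one_div_lt (abs_pos.2 hne)
    exact hω k ⟨hk, hωU⟩
  filter_upwards [measure_eq_zero_iff_ae_notMem.1 hnull] with ω hω
  exact Set.mem_iUnion.1 (not_not.1 hω)

/-- Sequential order continuity of a functional on `W`. -/
def IsOrderContinuousFunctional (φ : W →ₗ[ℝ] ℝ) : Prop :=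
  ∀ u : ℕ → W, (∀ n, 0 ≤ (u n : Ω →ₘ[μ] ℝ)) → Antitone (fun n => (u n : Ω →ₘ[μ] ℝ)) →
    (∀ᵐ ω ∂μ, Tendsto (fun n => (u n : Ω →ₘ[μ] ℝ) ω) atTop (𝓝 0)) →
    Tendsto (fun n => φ (u n)) atTop (𝓝 0)

open Classical in
/-- The values of `φ` as extended nonnegative numbers, extended by `0` to all of `L₀(μ)`. -/
def ennrealValue (φ : W →ₗ[ℝ] ℝ) (y : Ω →ₘ[μ] ℝ) : ℝ≥0∞ :=
  if h : y ∈ W then ENNReal.ofReal (φ ⟨y, h⟩) else 0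

theorem ennrealValue_of_mem (φ : W →ₗ[ℝ] ℝ) {y : Ω →ₘ[μ] ℝ} (h : y ∈ W) :
    ennrealValue φ y = ENNReal.ofReal (φ ⟨y, h⟩) := dif_pos h

theorem ennrealValue_ne_top (φ : W →ₗ[ℝ] ℝ) (y : Ω →ₘ[μ] ℝ) : ennrealValue φ y ≠ ∞ := by
  rw [ennrealValue]
  split_ifs
  · exact ENNReal.ofReal_ne_top
  · exact ENNReal.zero_ne_top

theorem ennrealValue_zero (φ : W →ₗ[ℝ] ℝ) : ennrealValue φ 0 = 0 := by
  rw [ennrealValue_of_mem φ W.zero_mem]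
  exact ENNReal.ofReal_eq_zero.2 (map_zero φ).le

/-- Solidity puts both summands in `W`; positivity of `φ` ensures that `ENNReal.ofReal` truncates
nothing. -/
theorem ennrealValue_add (hW : IsSolidSubspace W) {φ : W →ₗ[ℝ] ℝ}
    (hφ : ∀ y : W, 0 ≤ (y : Ω →ₘ[μ] ℝ) → 0 ≤ φ y) {y z : Ω →ₘ[μ] ℝ} (hy : 0 ≤ y) (hz : 0 ≤ z)
    (h : y + z ∈ W) : ennrealValue φ (y + z) = ennrealValue φ y + ennrealValue φ z := by
  have h1 : y ∈ W := hW.mem_of_le h hy (le_add_of_nonneg_right hz)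
  have h2 : z ∈ W := hW.mem_of_le h hz (le_add_of_nonneg_left hy)
  rw [ennrealValue_of_mem φ h, ennrealValue_of_mem φ h1, ennrealValue_of_mem φ h2,
    ← ENNReal.ofReal_add (hφ _ hy) (hφ _ hz), ← map_add]
  rfl

theorem ennrealValue_smul {φ : W →ₗ[ℝ] ℝ} {y : Ω →ₘ[μ] ℝ} (h : y ∈ W) {c : ℝ} (hc : 0 ≤ c) :
    ennrealValue φ (c • y) = ENNReal.ofReal c * ennrealValue φ y := by
  rw [ennrealValue_of_mem φ (W.smul_mem c h), ennrealValue_of_mem φ h, ← ENNReal.ofReal_mul hc,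
    ← smul_eq_mul, ← map_smul]
  rfl

theorem tendsto_ennrealValue (hW : IsSolidSubspace W) {φ : W →ₗ[ℝ] ℝ}
    (hcont : IsOrderContinuousFunctional φ) {u : ℕ → Ω →ₘ[μ] ℝ} {y : Ω →ₘ[μ] ℝ}
    (hu : ∀ n, 0 ≤ u n) (hmono : Monotone u) (hy : y ∈ W)
    (hlim : ∀ᵐ ω ∂μ, Tendsto (fun n => u n ω) atTop (𝓝 (y ω))) :
    Tendsto (fun n => ennrealValue φ (u n)) atTop (𝓝 (ennrealValue φ y)) := by
  have hle : ∀ n, u n ≤ y := by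
    intro n
    rw [← AEEqFun.coeFn_le]
    have hm : ∀ᵐ ω ∂μ, ∀ m, n ≤ m → u n ω ≤ u m ω :=
      ae_all_iff.2 fun m => by
        by_cases hnm : n ≤ m
        · filter_upwards [AEEqFun.coeFn_le.2 (hmono hnm)] with ω h _ using h
        · exact ae_of_all _ fun ω h => (hnm h).elim
    filter_upwards [hm, hlim] with ω h1 h2
    exact ge_of_tendsto h2 (eventually_atTop.2 ⟨n, h1⟩)
  have huW : ∀ n, u n ∈ W := fun n => hW.mem_of_le hy (hu n) (hle n)
  -- Order continuity at `0` is applied to `y - u n ↓ 0`.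
  have h := hcont (fun n => ⟨y, hy⟩ - ⟨u n, huW n⟩)
    (fun n => by simpa using hle n)
    (fun m n hmn => sub_le_sub_left (hmono hmn) y)
    (by
      filter_upwards [hlim, ae_all_iff.2 fun n => AEEqFun.coeFn_sub y (u n)] with ω h1 h2
      have h3 : Tendsto (fun n => y ω - u n ω) atTop (𝓝 0) := by
        simpa using (tendsto_const_nhds (x := y ω)).sub h1
      refine h3.congr fun n => ?_
      simpa using (h2 n).symm)
  have h' : Tendsto (fun n => φ ⟨u n, huW n⟩) atTop (𝓝 (φ ⟨y, hy⟩)) := by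
    simpa using (tendsto_const_nhds (x := φ ⟨y, hy⟩)).sub h
  simp only [ennrealValue_of_mem φ hy, ennrealValue_of_mem φ (huW _)]
  exact ENNReal.tendsto_ofReal h'

/-- Order continuity read as countable additivity: the partial unions inside `s` increase to `s`
almost everywhere. The cover may miss a null set, as the exhaustion of the space does. -/
theorem ennrealValue_indClass_eq_tsum (hW : IsSolidSubspace W) {φ : W →ₗ[ℝ] ℝ}
    (hφ : ∀ y : W, 0 ≤ (y : Ω →ₘ[μ] ℝ) → 0 ≤ φ y) (hcont : IsOrderContinuousFunctional φ)
    {s : Set Ω} (hs : MeasurableSet s) (hsW : indClass μ s ∈ W) {B : ℕ → Set Ω}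
    (hB : ∀ n, MeasurableSet (B n)) (hdisj : Pairwise (Function.onFun Disjoint B))
    (hcover : ∀ᵐ ω ∂μ, ω ∈ s → ∃ n, ω ∈ B n) :
    ennrealValue φ (indClass μ s) = ∑' n, ennrealValue φ (indClass μ (s ∩ B n)) := by
  let S : ℕ → Set Ω := fun N => s ∩ ⋃ i ∈ Finset.range N, B i
  have hS : ∀ N, MeasurableSet (S N) := fun N =>
    hs.inter (Finset.measurableSet_biUnion _ fun i _ => hB i)
  have hSmono : Monotone S := fun m n hmn => by
    refine Set.inter_subset_inter_right s (Set.biUnion_subset_biUnion_left fun i hi => ?_)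
    exact Finset.mem_coe.2 (Finset.range_mono hmn hi)
  have hsum : ∀ N, ∑ i ∈ Finset.range N, ennrealValue φ (indClass μ (s ∩ B i)) =
      ennrealValue φ (indClass μ (S N)) := by
    intro N
    induction N with
    | zero =>
      have : S 0 = ∅ := by simp [S]
      rw [this, indClass_eq_zero MeasurableSet.empty measure_empty, ennrealValue_zero,
        Finset.sum_range_zero]
    | succ N ih =>
      have hd : Disjoint (S N) (s ∩ B N) := by
        refine Set.disjoint_left.2 ?_
        rintro ω ⟨-, h1⟩ ⟨-, h2⟩
        obtain ⟨i, hi, hiω⟩ := Set.mem_iUnion₂.1 h1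
        exact Set.disjoint_left.1 (hdisj (Finset.mem_range.1 hi).ne) hiω h2
      have hunion : S (N + 1) = S N ∪ (s ∩ B N) := by
        simp only [S]
        rw [← Set.inter_union_distrib_left, Finset.range_add_one, Finset.set_biUnion_insert,
          Set.union_comm]
      have hmem : indClass μ (S (N + 1)) ∈ W :=
        hW.indClass_mem_of_subset (hS _) hs Set.inter_subset_left hsW
      rw [Finset.sum_range_succ, ih, hunion]
      rw [hunion] at hmem
      rw [indClass_union (hS N) (hs.inter (hB N)) hd] at hmem ⊢
      exact (ennrealValue_add hW hφ (indClass_nonneg (hS N))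
        (indClass_nonneg (hs.inter (hB N))) hmem).symm
  have hlim := tendsto_ennrealValue hW hcont (u := fun N => indClass μ (S N))
    (fun N => indClass_nonneg (hS N))
    (fun m n hmn => by
      rw [← AEEqFun.coeFn_le]
      filter_upwards [coeFn_indClass (hS m), coeFn_indClass (hS n)] with ω h1 h2
      rw [h1, h2]
      exact Set.indicator_le_indicator_of_subset (hSmono hmn) (fun _ => zero_le_one) ω)
    hsW
    (by
      filter_upwards [coeFn_indClass hs, ae_all_iff.2 fun N => coeFn_indClass (μ := μ) (hS N),
        hcover] with ω h1 h2 h3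
      simp only [h1, h2]
      by_cases hω : ω ∈ s
      · obtain ⟨n, hn⟩ := h3 hω
        refine tendsto_const_nhds.congr' (eventually_atTop.2 ⟨n + 1, fun N hN => ?_⟩)
        have : ω ∈ S N :=
          ⟨hω, Set.mem_iUnion₂.2 ⟨n, Finset.mem_range.2 hN, hn⟩⟩
        change _ = (S N).indicator (fun _ => (1 : ℝ)) ω
        rw [Set.indicator_of_mem hω, Set.indicator_of_mem this]
      · refine tendsto_const_nhds.congr fun N => ?_
        rw [Set.indicator_of_notMem hω, Set.indicator_of_notMem fun h => hω h.1])
  exact tendsto_nhds_unique hlim ((ENNReal.tendsto_nat_tsum _).congr hsum)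

/-- The class of the real part of an extended nonnegative function. -/
def toRealClass (μ : Measure Ω) {g : Ω → ℝ≥0∞} (hg : Measurable g) : Ω →ₘ[μ] ℝ :=
  AEEqFun.mk (fun ω => (g ω).toReal) hg.ennreal_toReal.aestronglyMeasurable

theorem coeFn_toRealClass {g : Ω → ℝ≥0∞} (hg : Measurable g) :
    ∀ᵐ ω ∂μ, toRealClass μ hg ω = (g ω).toReal := AEEqFun.coeFn_mk _ _

theorem toRealClass_nonneg {g : Ω → ℝ≥0∞} (hg : Measurable g) : 0 ≤ toRealClass μ hg := by
  rw [aeeqFun_nonneg_iff]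
  filter_upwards [coeFn_toRealClass hg] with ω h
  rw [h]
  exact ENNReal.toReal_nonneg

/-- A positive functional is given by a measure as soon as it is so on indicator functions. -/
theorem ennrealValue_toRealClass_eq_lintegral (hW : IsSolidSubspace W) {φ : W →ₗ[ℝ] ℝ}
    (hφ : ∀ y : W, 0 ≤ (y : Ω →ₘ[μ] ℝ) → 0 ≤ φ y) (hcont : IsOrderContinuousFunctional φ)
    {ν : Measure Ω} (hν : ∀ s, MeasurableSet s → indClass μ s ∈ W →
      ennrealValue φ (indClass μ s) = ν s) {g : Ω → ℝ≥0∞} (hg : Measurable g)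
    (hfin : ∀ ω, g ω ≠ ∞) (hgW : toRealClass μ hg ∈ W) :
    ennrealValue φ (toRealClass μ hg) = ∫⁻ ω, g ω ∂ν := by
  suffices H : ∀ hg : Measurable g, (∀ ω, g ω ≠ ∞) → toRealClass μ hg ∈ W →
      ennrealValue φ (toRealClass μ hg) = ∫⁻ ω, g ω ∂ν from H hg hfin hgW
  clear hfin hgW
  refine Measurable.ennreal_induction (motive := fun g => ∀ hg : Measurable g, (∀ ω, g ω ≠ ∞) →
    toRealClass μ hg ∈ W → ennrealValue φ (toRealClass μ hg) = ∫⁻ ω, g ω ∂ν) ?_ ?_ ?_ hg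
  · intro c s hs hg hfin hgW
    rw [lintegral_indicator_const hs]
    -- For empty `s` the value `c = ∞` is compatible with `hfin`; in all other cases `c` is finite.
    by_cases hc : c = 0 ∨ s = ∅
    · have h0 : toRealClass μ hg = 0 := by
        refine AEEqFun.ext ?_
        filter_upwards [coeFn_toRealClass (μ := μ) hg, AEEqFun.coeFn_zero (μ := μ) (β := ℝ)]
          with ω h1 h2
        rw [h1, h2]
        rcases hc with rfl | rfl <;> simp
      rw [h0, ennrealValue_zero]
      rcases hc with rfl | rfl <;> simp
    · push Not at hc
      obtain ⟨hc0, ω₀, hω₀⟩ := hc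
      have hctop : c ≠ ∞ := by simpa [Set.indicator_of_mem hω₀] using hfin ω₀
      have heq : toRealClass μ hg = c.toReal • indClass μ s := by
        refine AEEqFun.ext ?_
        filter_upwards [coeFn_toRealClass (μ := μ) hg, coeFn_indClass (μ := μ) hs,
          AEEqFun.coeFn_smul c.toReal (indClass μ s)] with ω h1 h2 h3
        rw [h1, h3, Pi.smul_apply, h2]
        by_cases hω : ω ∈ s <;> simp [hω]
      have hpos : 0 < c.toReal := ENNReal.toReal_pos hc0 hctop
      have hsW : indClass μ s ∈ W := by
        have := W.smul_mem c.toReal⁻¹ (heq ▸ hgW)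
        rwa [inv_smul_smul₀ hpos.ne'] at this
      rw [heq, ennrealValue_smul hsW hpos.le, hν s hs hsW, ENNReal.ofReal_toReal hctop]
  · intro f g hfg hf hg ihf ihg hg' hfin hgW
    have hff : ∀ ω, f ω ≠ ∞ := fun ω h => hfin ω (by simp [h])
    have hgf : ∀ ω, g ω ≠ ∞ := fun ω h => hfin ω (by simp [h])
    have heq : toRealClass μ hg' = toRealClass μ hf + toRealClass μ hg := by
      refine AEEqFun.ext ?_
      filter_upwards [coeFn_toRealClass (μ := μ) hg', coeFn_toRealClass (μ := μ) hf,
        coeFn_toRealClass (μ := μ) hg,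
        AEEqFun.coeFn_add (toRealClass μ hf) (toRealClass μ hg)] with ω h1 h2 h3 h4
      rw [h1, h4, Pi.add_apply, Pi.add_apply, h2, h3, ENNReal.toReal_add (hff ω) (hgf ω)]
    rw [heq] at hgW ⊢
    have h0 := toRealClass_nonneg (μ := μ) hf
    have h0' := toRealClass_nonneg (μ := μ) hg
    rw [ennrealValue_add hW hφ h0 h0' hgW,
      ihf hf hff (hW.mem_of_le hgW h0 (le_add_of_nonneg_right h0')),
      ihg hg hgf (hW.mem_of_le hgW h0' (le_add_of_nonneg_left h0))]
    simp only [Pi.add_apply]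
    rw [lintegral_add_left hf]
  · intro f hf hmono ih hg hfin hgW
    have hle : ∀ n ω, f n ω ≤ ⨆ n, f n ω := fun n ω => le_iSup (fun n => f n ω) n
    have hff : ∀ n ω, f n ω ≠ ∞ := fun n ω => ne_top_of_le_ne_top (hfin ω) (hle n ω)
    have hmono' : Monotone fun n => toRealClass μ (hf n) := fun m n hmn => by
      rw [← AEEqFun.coeFn_le]
      filter_upwards [coeFn_toRealClass (μ := μ) (hf m), coeFn_toRealClass (μ := μ) (hf n)]
        with ω h1 h2
      rw [h1, h2]
      exact ENNReal.toReal_mono (hff n ω) (hmono hmn ω)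
    have hlim := tendsto_ennrealValue hW hcont (fun n => toRealClass_nonneg (hf n)) hmono' hgW
      (by
        filter_upwards [coeFn_toRealClass (μ := μ) hg,
          ae_all_iff.2 fun n => coeFn_toRealClass (μ := μ) (hf n)] with ω h1 h2
        simp only [h1, h2]
        exact (ENNReal.tendsto_toReal (hfin ω)).comp
          (tendsto_atTop_iSup fun m n hmn => hmono hmn ω))
    have hmem : ∀ n, toRealClass μ (hf n) ∈ W := fun n => by
      refine hW.mem_of_le hgW (toRealClass_nonneg (hf n)) ?_
      rw [← AEEqFun.coeFn_le]
      filter_upwards [coeFn_toRealClass (μ := μ) (hf n), coeFn_toRealClass (μ := μ) hg]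
        with ω h1 h2
      rw [h1, h2]
      exact ENNReal.toReal_mono (hfin ω) (hle n ω)
    rw [lintegral_iSup hf hmono]
    refine tendsto_nhds_unique (hlim.congr fun n => ih n (hf n) (hff n) (hmem n))
      (tendsto_atTop_iSup fun m n hmn => lintegral_mono (hmono hmn))

/-- A positive order continuous functional on a solid subspace of `L₀(μ)` with full support is
given by a density. -/
theorem exists_density_of_orderContinuous [SigmaFinite μ] (hW : IsSolidSubspace W)
    (hfull : HasFullSupport W) {φ : W →ₗ[ℝ] ℝ}
    (hφ : ∀ y : W, 0 ≤ (y : Ω →ₘ[μ] ℝ) → 0 ≤ φ y) (hcont : IsOrderContinuousFunctional φ) :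
    ∃ h : Ω → ℝ≥0∞, Measurable h ∧ (∀ᵐ ω ∂μ, h ω ≠ ∞) ∧
      ∀ y : W, 0 ≤ (y : Ω →ₘ[μ] ℝ) →
        ENNReal.ofReal (φ y) = ∫⁻ ω, h ω * ENNReal.ofReal ((y : Ω →ₘ[μ] ℝ) ω) ∂μ := by
  obtain ⟨A, -, hAm, hAW, hA⟩ := exists_exhausting_indClass_mem hW hfull
  set D := disjointed A with hD
  have hDm : ∀ n, MeasurableSet (D n) := fun n => MeasurableSet.disjointed hAm n
  have hDW : ∀ n, indClass μ (D n) ∈ W := fun n =>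
    hW.indClass_mem_of_subset (hDm n) (hAm n) (disjointed_subset A n) (hAW n)
  have hDdisj : Pairwise (Function.onFun Disjoint D) := disjoint_disjointed A
  have hDcover : ∀ᵐ ω ∂μ, ∃ n, ω ∈ D n := by
    filter_upwards [hA] with ω hω
    rw [← Set.mem_iUnion, hD, iUnion_disjointed]
    exact Set.mem_iUnion.2 hω
  -- The full set function need not be defined on all measurable sets, since indicators may leave
  -- `W`. Cut down to the pieces `D n` it gives finite measures, whose sum has a density with
  -- respect to `μ`.
  let ν : ℕ → Measure Ω := fun n => Measure.ofMeasurable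
    (fun s _ => ennrealValue φ (indClass μ (s ∩ D n)))
    (by
      simp only [Set.empty_inter]
      rw [indClass_eq_zero MeasurableSet.empty measure_empty, ennrealValue_zero])
    (fun B hB hdisj => by
      have hm : MeasurableSet ((⋃ i, B i) ∩ D n) := (MeasurableSet.iUnion hB).inter (hDm n)
      rw [ennrealValue_indClass_eq_tsum hW hφ hcont hm
        (hW.indClass_mem_of_subset hm (hDm n) Set.inter_subset_right (hDW n)) hB hdisj
        (ae_of_all _ fun ω hω => Set.mem_iUnion.1 hω.1)]
      refine tsum_congr fun i => ?_
      congr 2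
      ext ω
      simp only [Set.mem_inter_iff, Set.mem_iUnion]
      exact ⟨fun h => ⟨h.2, h.1.2⟩, fun h => ⟨⟨⟨i, h.1⟩, h.2⟩, h.1⟩⟩)
  have hνapp : ∀ n s, MeasurableSet s → ν n s = ennrealValue φ (indClass μ (s ∩ D n)) :=
    fun n s hs => Measure.ofMeasurable_apply s hs
  have hνfin : ∀ n, IsFiniteMeasure (ν n) := fun n =>
    ⟨by rw [hνapp n _ MeasurableSet.univ]; exact (ennrealValue_ne_top φ _).lt_top⟩
  have hνac : Measure.sum ν ≪ μ := by
    refine Measure.AbsolutelyContinuous.mk fun s hs h0 => ?_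
    rw [Measure.sum_apply _ hs, ENNReal.tsum_eq_zero]
    intro n
    rw [hνapp n s hs, indClass_eq_zero (hs.inter (hDm n))
      (measure_mono_null Set.inter_subset_left h0), ennrealValue_zero]
  set h := (Measure.sum ν).rnDeriv μ with hh
  have hhm : Measurable h := Measure.measurable_rnDeriv _ _
  have hrep : ∀ y : W, 0 ≤ (y : Ω →ₘ[μ] ℝ) →
      ENNReal.ofReal (φ y) = ∫⁻ ω, h ω * ENNReal.ofReal ((y : Ω →ₘ[μ] ℝ) ω) ∂μ := by
    intro y hy
    have hgm : Measurable fun ω => ENNReal.ofReal ((y : Ω →ₘ[μ] ℝ) ω) :=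
      (y : Ω →ₘ[μ] ℝ).measurable.ennreal_ofReal
    have hcl : toRealClass μ hgm = y := by
      refine AEEqFun.ext ?_
      filter_upwards [coeFn_toRealClass (μ := μ) hgm, aeeqFun_nonneg_iff.1 hy] with ω h1 h2
      rw [h1, ENNReal.toReal_ofReal h2]
    have key := ennrealValue_toRealClass_eq_lintegral hW hφ hcont (ν := Measure.sum ν)
      (fun s hs hsW => by
        rw [Measure.sum_apply _ hs, ennrealValue_indClass_eq_tsum hW hφ hcont hs hsW hDm hDdisj
          (by filter_upwards [hDcover] with ω hω _ using hω)]
        exact tsum_congr fun n => (hνapp n s hs).symm)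
      hgm (fun ω => ENNReal.ofReal_ne_top) (by rw [hcl]; exact y.2)
    rw [hcl, ennrealValue_of_mem φ y.2] at key
    rw [lintegral_rnDeriv_mul hνac hgm.aemeasurable]
    exact key
  refine ⟨h, hhm, ?_, hrep⟩
  -- The integral of `h` over `A n` is the finite number `φ` of its indicator, and the `A n` exhaust
  -- the space.
  have hfin : ∀ n, ∀ᵐ ω ∂μ, ω ∈ A n → h ω ≠ ∞ := by
    intro n
    have h1 := hrep ⟨_, hAW n⟩ (indClass_nonneg (hAm n))
    have h2 : ∫⁻ ω, h ω * ENNReal.ofReal (indClass μ (A n) ω) ∂μ ≠ ∞ := by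
      rw [← h1]
      exact ENNReal.ofReal_ne_top
    filter_upwards [ae_lt_top (by fun_prop) h2, coeFn_indClass (hAm n)] with ω h3 h4 h5 h6
    rw [h4, Set.indicator_of_mem h5, h6] at h3
    simp at h3
  filter_upwards [hA, ae_all_iff.2 hfin] with ω ⟨n, hn⟩ h2
  exact h2 n hn

end IntegralRepresentation

end

/-! ### The weight `f` and multiplication into `L_r(μ)` -/

noncomputable section

namespace QuasiKotheSpace

open scoped ENNReal

variable {Ω : Type*} [MeasurableSpace Ω] {μ : Measure Ω} (X : QuasiKotheSpace μ)
  {r : ℝ} (hr : 0 < r)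

theorem isSolidSubspace_power : IsSolidSubspace (X.power r hr) := by
  intro x y hy h
  refine X.solid_mem _ _ hy ?_
  rw [abs_absPow, abs_absPow]
  exact absPow_mono h (one_div_pos.2 hr).le

theorem hasFullSupport_power : HasFullSupport (X.power r hr) := by
  intro A hA h
  refine X.full_support A hA fun x hx => ?_
  filter_upwards [h _ (X.absPow_mem_power hr ⟨x, hx⟩), coeFn_absPow x r] with ω h1 h2 h3
  have h4 := h1 h3
  rw [h2, Real.rpow_eq_zero (abs_nonneg _) hr.ne'] at h4
  exact abs_eq_zero.1 h4

/-- If `u n ↓ 0` in `X^r`, then `u n ^ (1 / r) ↓ 0` in `X`, so its norms tend to `0` and the upper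
bound carries this over to `φ (u n)`. -/
theorem isOrderContinuousFunctional_of_le (hX : X.SigmaOrderContinuous)
    {φ : X.power r hr →ₗ[ℝ] ℝ} (hpos : ∀ y : X.power r hr, 0 ≤ (y : Ω →ₘ[μ] ℝ) → 0 ≤ φ y)
    {C : ℝ} (hle : ∀ x, φ (X.toPower hr x) ≤ (C * X.nrm x) ^ r) :
    IsOrderContinuousFunctional φ := by
  intro u hu hanti hlim
  have h := hX (fun n => X.root hr (u n)) (fun n => (X.root hr (u n)).2)
    (fun n => absPow_nonneg _ _)
    (fun m n hmn => absPow_mono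
      (by rw [abs_of_nonneg (hu m), abs_of_nonneg (hu n)]; exact hanti hmn) (one_div_pos.2 hr).le)
    (by
      filter_upwards [hlim, ae_all_iff.2 fun n => coeFn_absPow (u n : Ω →ₘ[μ] ℝ) (1 / r)]
        with ω h1 h2
      have h3 := (h1.abs).rpow_const (p := 1 / r) (Or.inr (one_div_pos.2 hr).le)
      rw [abs_zero, Real.zero_rpow (one_div_pos.2 hr).ne'] at h3
      exact h3.congr fun n => (h2 n).symm)
  have h' := (h.const_mul C).rpow_const (p := r) (Or.inr hr.le)
  rw [mul_zero, Real.zero_rpow hr.ne'] at h'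
  refine squeeze_zero (fun n => hpos _ (hu n)) (fun n => ?_) h'
  have := hle (X.root hr (u n))
  rwa [toPower_root X hr (hu n)] at this

/-- Multiplication by `f`, as a linear map from `X` into `L_p(μ)`. -/
def mulLp (f : Ω →ₘ[μ] ℝ) {p : ℝ≥0∞} (hf : ∀ x : X.carrier, f * (x : Ω →ₘ[μ] ℝ) ∈ Lp ℝ p μ) :
    X.carrier →ₗ[ℝ] Lp ℝ p μ where
  toFun x := ⟨f * (x : Ω →ₘ[μ] ℝ), hf x⟩
  map_add' x y := by
    refine Subtype.ext (AEEqFun.ext ?_)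
    filter_upwards [AEEqFun.coeFn_mul f ((x : Ω →ₘ[μ] ℝ) + (y : Ω →ₘ[μ] ℝ)),
      AEEqFun.coeFn_mul f (x : Ω →ₘ[μ] ℝ), AEEqFun.coeFn_mul f (y : Ω →ₘ[μ] ℝ),
      AEEqFun.coeFn_add (x : Ω →ₘ[μ] ℝ) (y : Ω →ₘ[μ] ℝ),
      AEEqFun.coeFn_add (f * (x : Ω →ₘ[μ] ℝ)) (f * (y : Ω →ₘ[μ] ℝ))] with ω h1 h2 h3 h4 h5
    change (f * ((x : Ω →ₘ[μ] ℝ) + (y : Ω →ₘ[μ] ℝ))) ω =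
      (f * (x : Ω →ₘ[μ] ℝ) + f * (y : Ω →ₘ[μ] ℝ)) ω
    rw [h1, h5, Pi.mul_apply, Pi.add_apply, h2, h3, h4, Pi.add_apply, Pi.mul_apply, Pi.mul_apply,
      mul_add]
  map_smul' c x := by
    refine Subtype.ext (AEEqFun.ext ?_)
    filter_upwards [AEEqFun.coeFn_mul f (c • (x : Ω →ₘ[μ] ℝ)),
      AEEqFun.coeFn_mul f (x : Ω →ₘ[μ] ℝ), AEEqFun.coeFn_smul c (x : Ω →ₘ[μ] ℝ),
      AEEqFun.coeFn_smul c (f * (x : Ω →ₘ[μ] ℝ))] with ω h1 h2 h3 h4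
    change (f * (c • (x : Ω →ₘ[μ] ℝ))) ω = (c • (f * (x : Ω →ₘ[μ] ℝ))) ω
    rw [h1, h4, Pi.mul_apply, Pi.smul_apply, h2, h3, Pi.smul_apply, Pi.mul_apply, smul_eq_mul,
      smul_eq_mul, mul_left_comm]

theorem coeFn_mulLp (f : Ω →ₘ[μ] ℝ) {p : ℝ≥0∞}
    (hf : ∀ x : X.carrier, f * (x : Ω →ₘ[μ] ℝ) ∈ Lp ℝ p μ) (x : X.carrier) :
    ∀ᵐ ω ∂μ, X.mulLp f hf x ω = f ω * (x : Ω →ₘ[μ] ℝ) ω :=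
  AEEqFun.coeFn_mul f (x : Ω →ₘ[μ] ℝ)

end QuasiKotheSpace

/-! ### Restriction to the support and convergence in `L_p(μ)` -/

section Support

open scoped ENNReal

variable {Ω : Type*} [MeasurableSpace Ω] {μ : Measure Ω}

/-- Multiplication with the indicator function of a measurable set on `L_p(μ)`. -/
def indicatorLp (p : ℝ≥0∞) {s : Set Ω} (hs : MeasurableSet s) : Lp ℝ p μ →ₗ[ℝ] Lp ℝ p μ where
  toFun g := ((Lp.memLp g).indicator hs).toLp _
  map_add' g g' := by
    rw [← MemLp.toLp_add, MemLp.toLp_eq_toLp_iff]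
    filter_upwards [Lp.coeFn_add g g'] with ω h
    rw [Pi.add_apply] at h
    by_cases hω : ω ∈ s
    · rw [Pi.add_apply, Set.indicator_of_mem hω, Set.indicator_of_mem hω, Set.indicator_of_mem hω, h]
    · rw [Pi.add_apply, Set.indicator_of_notMem hω, Set.indicator_of_notMem hω,
        Set.indicator_of_notMem hω, add_zero]
  map_smul' c g := by
    rw [RingHom.id_apply, ← MemLp.toLp_const_smul, MemLp.toLp_eq_toLp_iff]
    filter_upwards [Lp.coeFn_smul c g] with ω h
    rw [Pi.smul_apply] at h
    by_cases hω : ω ∈ s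
    · rw [Pi.smul_apply, Set.indicator_of_mem hω, Set.indicator_of_mem hω, h]
    · rw [Pi.smul_apply, Set.indicator_of_notMem hω, Set.indicator_of_notMem hω, smul_zero]

theorem coeFn_indicatorLp (p : ℝ≥0∞) {s : Set Ω} (hs : MeasurableSet s) (g : Lp ℝ p μ) :
    ∀ᵐ ω ∂μ, indicatorLp p hs g ω = s.indicator g ω := by
  have h : indicatorLp p hs g = ((Lp.memLp g).indicator hs).toLp _ := rfl
  rw [h]
  exact MemLp.coeFn_toLp _

theorem norm_indicatorLp_le (p : ℝ≥0∞) {s : Set Ω} (hs : MeasurableSet s) (g : Lp ℝ p μ) :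
    ‖indicatorLp p hs g‖ ≤ ‖g‖ := by
  refine Lp.norm_le_norm_of_ae_le ?_
  filter_upwards [coeFn_indicatorLp p hs g] with ω h
  rw [h]
  exact norm_indicator_le_norm_self _ _

/-- Dominated convergence in `L_p(μ)` for sequences that are eventually constant pointwise. -/
theorem Lp.tendsto_of_eventually_eq {p : ℝ≥0∞} [Fact (1 ≤ p)] (hp : p ≠ ∞) {u : ℕ → Lp ℝ p μ}
    {v g : Lp ℝ p μ} (hbound : ∀ n, ∀ᵐ ω ∂μ, ‖u n ω - v ω‖ ≤ ‖g ω‖)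
    (hev : ∀ᵐ ω ∂μ, ∀ᶠ n in atTop, u n ω = v ω) : Tendsto u atTop (𝓝 v) := by
  have hp0 : p ≠ 0 := (zero_lt_one.trans_le (Fact.out : 1 ≤ p)).ne'
  have hpr : 0 < p.toReal := ENNReal.toReal_pos hp0 hp
  rw [Lp.tendsto_Lp_iff_tendsto_eLpNorm']
  have h : Tendsto (fun n => ∫⁻ ω, ‖(u n - v : Ω → ℝ) ω‖ₑ ^ p.toReal ∂μ) atTop
      (𝓝 (∫⁻ _, 0 ∂μ)) := by
    refine tendsto_lintegral_of_dominated_convergence' (fun ω => ‖g ω‖ₑ ^ p.toReal)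
      (fun n => ?_) (fun n => ?_) ?_ ?_
    · exact (((Lp.aestronglyMeasurable (u n)).sub
        (Lp.aestronglyMeasurable v)).enorm).pow_const _
    · filter_upwards [hbound n] with ω hω
      exact ENNReal.rpow_le_rpow (enorm_le_iff_norm_le.2 hω) hpr.le
    · exact (lintegral_rpow_enorm_lt_top_of_eLpNorm_lt_top hp0 hp (Lp.eLpNorm_lt_top g)).ne
    · filter_upwards [hev] with ω hω
      refine tendsto_const_nhds.congr' ?_
      filter_upwards [hω] with n hn
      simp [hn, hpr]
  rw [lintegral_zero] at h
  have h' := (ENNReal.continuous_rpow_const (y := 1 / p.toReal)).continuousAt.tendsto.comp h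
  rw [ENNReal.zero_rpow_of_pos (one_div_pos.2 hpr)] at h'
  refine h'.congr fun n => ?_
  rw [eLpNorm_eq_lintegral_rpow_enorm_toReal hp0 hp]
  rfl

end Support

/-! ### Density of the range of multiplication, and construction of the weight -/

namespace QuasiKotheSpace

open scoped ENNReal

variable {Ω : Type*} [MeasurableSpace Ω] {μ : Measure Ω} (X : QuasiKotheSpace μ)

/-- The functions `f x`, with `x` in `X`, are dense in the part of `L_p(μ)` carried by the support
of `f`. -/
theorem indicatorLp_mem_closure_range_mulLp [SFinite μ] {p : ℝ≥0∞} [Fact (1 ≤ p)] (hp : p ≠ ∞)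
    (f : Ω →ₘ[μ] ℝ) (hf : ∀ x : X.carrier, f * (x : Ω →ₘ[μ] ℝ) ∈ Lp ℝ p μ)
    (hs : MeasurableSet {ω | f ω ≠ 0}) (g : Lp ℝ p μ) :
    indicatorLp p hs g ∈ closure (Set.range (X.mulLp f hf)) := by
  obtain ⟨A, hAmono, hAm, hAX, hA⟩ := exists_exhausting_indClass_mem (W := X.carrier)
    X.solid_mem X.full_support
  have hgm : Measurable g := (Lp.stronglyMeasurable g).measurable
  -- On `D n` the quotient `g / f` is bounded by `n`, and `D n ⊆ A n`, so its truncation is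
  -- dominated by `n` times an indicator in `X`. The sets `D n` increase to `{f ≠ 0}` up to a null
  -- set.
  let D : ℕ → Set Ω := fun n => A n ∩ {ω | |g ω| ≤ n * |f ω|} ∩ {ω | f ω ≠ 0}
  have hD : ∀ n, MeasurableSet (D n) := fun n =>
    ((hAm n).inter (measurableSet_le (measurable_norm.comp hgm)
      ((measurable_norm.comp f.measurable).const_mul _))).inter hs
  have hm : ∀ n, AEStronglyMeasurable ((D n).indicator fun ω => g ω / f ω) μ := fun n =>
    ((hgm.div f.measurable).indicator (hD n)).aestronglyMeasurable
  have hx : ∀ n, AEEqFun.mk _ (hm n) ∈ X.carrier := fun n => by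
    refine X.mem_of_ae_bound (X.carrier.smul_mem (n : ℝ) (hAX n)) ?_
    filter_upwards [AEEqFun.coeFn_mk _ (hm n), coeFn_indClass (hAm n),
      AEEqFun.coeFn_smul (n : ℝ) (indClass μ (A n))] with ω h1 h2 h3
    rw [h1, h3, Pi.smul_apply, h2, smul_eq_mul]
    by_cases hω : ω ∈ D n
    · rw [Set.indicator_of_mem hω, Set.indicator_of_mem hω.1.1, mul_one, Nat.abs_cast, abs_div,
        div_le_iff₀ (abs_pos.2 hω.2)]
      exact hω.1.2
    · rw [Set.indicator_of_notMem hω, abs_zero]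
      exact abs_nonneg _
  have hM : ∀ n, ∀ᵐ ω ∂μ, X.mulLp f hf ⟨_, hx n⟩ ω = (D n).indicator g ω := fun n => by
    filter_upwards [X.coeFn_mulLp f hf ⟨_, hx n⟩, AEEqFun.coeFn_mk _ (hm n)] with ω h1 h2
    rw [h1, h2]
    by_cases hω : ω ∈ D n
    · rw [Set.indicator_of_mem hω, Set.indicator_of_mem hω, mul_div_cancel₀ _ hω.2]
    · rw [Set.indicator_of_notMem hω, Set.indicator_of_notMem hω, mul_zero]
  refine mem_closure_of_tendsto (Lp.tendsto_of_eventually_eq hp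
    (u := fun n => X.mulLp f hf ⟨_, hx n⟩) (g := g) (fun n => ?_) ?_)
    (Eventually.of_forall fun n => Set.mem_range_self _)
  · filter_upwards [hM n, coeFn_indicatorLp p hs g] with ω h1 h2
    rw [h1, h2]
    by_cases hω : ω ∈ D n
    · rw [Set.indicator_of_mem hω, Set.indicator_of_mem hω.2, sub_self, norm_zero]
      exact norm_nonneg _
    · rw [Set.indicator_of_notMem hω, zero_sub, norm_neg]
      exact norm_indicator_le_norm_self _ _
  · filter_upwards [ae_all_iff.2 hM, coeFn_indicatorLp p hs g, hA] with ω h1 h2 h3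
    by_cases hω : f ω = 0
    · refine Eventually.of_forall fun n => ?_
      rw [h1, h2, Set.indicator_of_notMem (fun h : ω ∈ D n => h.2 hω),
        Set.indicator_of_notMem (fun h : ω ∈ {ω | f ω ≠ 0} => h hω)]
    · obtain ⟨k, hk⟩ := h3
      obtain ⟨m, hm⟩ := exists_nat_ge (|g ω| / |f ω|)
      refine eventually_atTop.2 ⟨max k m, fun n hn => ?_⟩
      have hωD : ω ∈ D n := by
        refine ⟨⟨hAmono ((le_max_left k m).trans hn) hk, ?_⟩, hω⟩
        rw [div_le_iff₀ (abs_pos.2 hω)] at hm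
        have : (m : ℝ) ≤ n := Nat.cast_le.2 ((le_max_right k m).trans hn)
        exact hm.trans (mul_le_mul_of_nonneg_right this (abs_nonneg _))
      rw [h1, h2, Set.indicator_of_mem hωD, Set.indicator_of_mem hωD.2]

/-- Every positive functional on `X^r` with an order continuity property is of the form
`φ(|x| ^ r) = ‖f x‖ ^ r`, with the norm of `L_r(μ)`. -/
theorem exists_weight_of_functional [SigmaFinite μ] {r : ℝ} (hr : 0 < r)
    {φ : X.power r hr →ₗ[ℝ] ℝ} (hpos : ∀ y : X.power r hr, 0 ≤ (y : Ω →ₘ[μ] ℝ) → 0 ≤ φ y)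
    (hcont : IsOrderContinuousFunctional φ) :
    ∃ f : Ω →ₘ[μ] ℝ, 0 ≤ f ∧
      ∃ hf : ∀ x : X.carrier, f * (x : Ω →ₘ[μ] ℝ) ∈ Lp ℝ (ENNReal.ofReal r) μ,
        ∀ x, ‖X.mulLp f hf x‖ = φ (X.toPower hr x) ^ (1 / r) := by
  obtain ⟨h, hm, htop, hrep⟩ := exists_density_of_orderContinuous (X.isSolidSubspace_power hr)
    (X.hasFullSupport_power hr) hpos hcont
  -- The weight is `f = h ^ (1 / r)`, so that `|f x| ^ r = h |x| ^ r` integrates to `φ (|x| ^ r)`.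
  have hfm : Measurable fun ω => (h ω).toReal ^ (1 / r) := hm.ennreal_toReal.pow_const _
  set f : Ω →ₘ[μ] ℝ := AEEqFun.mk _ hfm.aestronglyMeasurable with hf
  have hfae : ∀ᵐ ω ∂μ, f ω = (h ω).toReal ^ (1 / r) := AEEqFun.coeFn_mk _ _
  have hp0 : ENNReal.ofReal r ≠ 0 := (ENNReal.ofReal_pos.2 hr).ne'
  have hptop : ENNReal.ofReal r ≠ ∞ := ENNReal.ofReal_ne_top
  have hpr : (ENNReal.ofReal r).toReal = r := ENNReal.toReal_ofReal hr.le
  have hint : ∀ x : X.carrier, ∫⁻ ω, ‖(f * (x : Ω →ₘ[μ] ℝ)) ω‖ₑ ^ r ∂μ =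
      ENNReal.ofReal (φ (X.toPower hr x)) := by
    intro x
    rw [hrep _ (X.toPower_nonneg hr x)]
    refine lintegral_congr_ae ?_
    filter_upwards [AEEqFun.coeFn_mul f (x : Ω →ₘ[μ] ℝ), hfae, htop,
      coeFn_absPow (x : Ω →ₘ[μ] ℝ) r] with ω h1 h2 h3 h4
    rw [h1, Pi.mul_apply, h2, coe_toPower, h4, Real.enorm_eq_ofReal_abs,
      ENNReal.ofReal_rpow_of_nonneg (abs_nonneg _) hr.le, abs_mul,
      Real.mul_rpow (abs_nonneg _) (abs_nonneg _),
      abs_of_nonneg (Real.rpow_nonneg ENNReal.toReal_nonneg _),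
      ← Real.rpow_mul ENNReal.toReal_nonneg, one_div_mul_cancel hr.ne', Real.rpow_one,
      ENNReal.ofReal_mul ENNReal.toReal_nonneg, ENNReal.ofReal_toReal h3]
  have hnorm : ∀ x : X.carrier, eLpNorm (f * (x : Ω →ₘ[μ] ℝ)) (ENNReal.ofReal r) μ =
      ENNReal.ofReal (φ (X.toPower hr x)) ^ (1 / r) := by
    intro x
    rw [eLpNorm_eq_lintegral_rpow_enorm_toReal hp0 hptop, hpr, hint]
  refine ⟨f, ?_, fun x => ?_, fun x => ?_⟩
  · rw [aeeqFun_nonneg_iff]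
    filter_upwards [hfae] with ω h1
    rw [h1]
    exact Real.rpow_nonneg ENNReal.toReal_nonneg _
  · rw [Lp.mem_Lp_iff_eLpNorm_lt_top, hnorm]
    exact ENNReal.rpow_lt_top_of_nonneg (one_div_pos.2 hr).le ENNReal.ofReal_ne_top
  · rw [Lp.norm_def]
    change (eLpNorm (f * (x : Ω →ₘ[μ] ℝ) : Ω →ₘ[μ] ℝ) (ENNReal.ofReal r) μ).toReal = _
    rw [hnorm, ← ENNReal.toReal_rpow,
      ENNReal.toReal_ofReal (hpos _ (X.toPower_nonneg hr x))]

end QuasiKotheSpace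

end

/-! ### Domination and factorization -/

theorem corollary5 {Ω : Type*} [MeasurableSpace Ω] (μ : Measure Ω) [SigmaFinite μ]
    (X : QuasiKotheSpace μ) (hX : X.IsQuasiBanach)
    {F : Type*} [AddCommGroup F] [Module ℝ F] (q : F → ℝ) (hq : IsQuasiBanachNorm q)
    (r : ℝ) (hr : 0 < r) (hconv : X.IsConvex r)
    (T : X.carrier → F) (hhom : ∀ c : ℝ, 0 ≤ c → ∀ x, T (c • x) = c • T x)
    (hT : X.IsConcaveMap q T r) :
    (∃ φ : X.power r hr →ₗ[ℝ] ℝ,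
      (∀ y : X.power r hr, 0 ≤ (y : Ω →ₘ[μ] ℝ) → 0 ≤ φ y) ∧
      (∀ x, X.nrm x ≤ 1 →
        φ (X.toPower hr x) ^ (1 / r) ≤ X.concavityConst q T r * X.convexityConst r) ∧
      ∀ x, q (T x) ≤ φ (X.toPower hr x) ^ (1 / r)) ∧
    (X.SigmaOrderContinuous → IsLinearMap ℝ T → 1 ≤ r →
      ∃ (f : Ω →ₘ[μ] ℝ) (M : X.carrier →ₗ[ℝ] Lp ℝ (ENNReal.ofReal r) μ)
        (R : Lp ℝ (ENNReal.ofReal r) μ →ₗ[ℝ] F),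
        0 ≤ f ∧ (∀ x, (M x : Ω →ₘ[μ] ℝ) = f * x) ∧
        IsBoundedFor X.nrm (fun g => ‖g‖) M ∧ IsBoundedFor (fun g => ‖g‖) q R ∧
        (∀ x, T x = R (M x)) ∧
        (IsContinuousFor q →
          opNormFor X.nrm (fun g => ‖g‖) M * opNormFor (fun g => ‖g‖) q R ≤
            X.concavityConst q T r * X.convexityConst r)) := by
  have hqn := hq.toIsQuasiNorm
  have hr' : 0 < 1 / r := one_div_pos.2 hr
  have hC : 0 ≤ X.concavityConst q T r * X.convexityConst r :=
    mul_nonneg (X.concavityConst_mem hT).1 (X.convexityConst_mem hconv).1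
  obtain ⟨φ, hpos, hupper, hlower⟩ := X.exists_dominating_functional hr hqn hconv hhom hT
  set C := X.concavityConst q T r * X.convexityConst r
  have hup : ∀ x, φ (X.toPower hr x) ^ (1 / r) ≤ C * X.nrm x := fun x => by
    have h0 : 0 ≤ C * X.nrm x := mul_nonneg hC (X.nrm_nonneg x)
    have h := Real.rpow_le_rpow (hpos _ (X.toPower_nonneg hr x)) (hupper x) hr'.le
    rwa [← Real.rpow_mul h0, mul_one_div_cancel hr.ne', Real.rpow_one] at h
  have hlow : ∀ x, q (T x) ≤ φ (X.toPower hr x) ^ (1 / r) := fun x => by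
    have h := Real.rpow_le_rpow (Real.rpow_nonneg (hqn.nonneg _) r) (hlower x) hr'.le
    rwa [← Real.rpow_mul (hqn.nonneg _), mul_one_div_cancel hr.ne', Real.rpow_one] at h
  refine ⟨⟨φ, hpos, fun x hx => (hup x).trans (mul_le_of_le_one_right hC hx), hlow⟩,
    fun hoc hlin h1 => ?_⟩
  -- Here `1 ≤ r` makes `L_r(μ)` a normed space.
  have hfact : Fact (1 ≤ ENNReal.ofReal r) := ⟨by simpa using ENNReal.ofReal_le_ofReal h1⟩
  obtain ⟨f, hf0, hf, hnorm⟩ := X.exists_weight_of_functional hr hpos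
    (X.isOrderContinuousFunctional_of_le hr hoc hpos hupper)
  have hs : MeasurableSet {ω | f ω ≠ 0} := (measurableSet_eq_fun f.measurable measurable_const).compl
  -- The contraction `P` is restriction to `{f ≠ 0}`; it fixes each `f x`, which vanishes off that
  -- set.
  obtain ⟨R, hRM, hRb, hRc⟩ := exists_factorization_of_le_norm hq (hlin.mk' T) (X.mulLp f hf)
    (fun x => by rw [hnorm]; exact hlow x) (indicatorLp _ hs) (norm_indicatorLp_le _ hs)
    (fun x => by
      refine Lp.ext ?_
      filter_upwards [coeFn_indicatorLp _ hs (X.mulLp f hf x), X.coeFn_mulLp f hf x] with ω h2 h3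
      rw [h2, Set.indicator_apply_eq_self, h3]
      intro h4
      rw [not_not.1 h4, zero_mul])
    (X.indicatorLp_mem_closure_range_mulLp ENNReal.ofReal_ne_top f hf hs)
  have hMb : ∀ x, ‖X.mulLp f hf x‖ ≤ C * X.nrm x := fun x => by rw [hnorm]; exact hup x
  refine ⟨f, X.mulLp f hf, R, hf0, fun x => rfl, ⟨C, hC, hMb⟩, hRb, fun x => (hRM x).symm,
    fun hc => ?_⟩
  have hMop : opNormFor X.nrm (fun g => ‖g‖) (X.mulLp f hf) ≤ C :=
    csInf_le ⟨0, fun c h => h.1⟩ ⟨hC, hMb⟩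
  -- All of the constant `C` is carried by `M`; for continuous `q`, `R` is a contraction.
  have hRop : opNormFor (fun g => ‖g‖) q R ≤ 1 :=
    csInf_le ⟨0, fun c h => h.1⟩ ⟨zero_le_one, fun g => by simpa using hRc hc g⟩
  have hRop0 : 0 ≤ opNormFor (fun g => ‖g‖) q R := Real.sInf_nonneg fun c h => h.1
  simpa using mul_le_mul hMop hRop hRop0 hC
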